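/- Conventions. A Grothendieck category is a cocomplete abelian category with a set of generators in which direct limits (colimits over directed sets) are exact; a class $\mathcal S$ of objects is a class of generators if every object is an epimorphic image of a (set-indexed) coproduct of objects of $\mathcal S$. An object $X$ is finitely presented if $\mathrm{Hom}(X,-)$ preserves direct limits, and $\mathrm{fp}(\mathcal G)$ denotes the full subcategory of finitely presented objects of $\mathcal G$. A Grothendieck category $\mathcal G$ is locally coherent if it has a set of finitely presented generators and $\mathrm{fp}(\mathcal G)$ is an abelian exact subcategory, i.e. closed under finite (co)products, kernels and cokernels in $\mathcal G$. For such $\mathcal G$, $\mathcal D^b(\mathrm{fp}(\mathcal G))$ is identified with the full subcategory of the derived category $\mathcal D(\mathcal G)$ consisting of the complexes $X$ with bounded homology such that $H^i(X)\in\mathrm{fp}(\mathcal G)$ for all $i\in\mathbb Z$. For $k\in\mathbb Z$, $\mathcal D^{\le k}(\mathcal G)$ consists of the complexes $X$ with $H^i(X)=0$ for all $i>k$. A t-structure $(\mathcal U,\mathcal U^\perp[1])$ in $\mathcal D(\mathcal G)$ restricts to a full triangulated subcategory $\mathcal D'$ if for every $X\in\mathcal D'$ the truncation triangle $U\to X\to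 V\to U[1]$, with $U\in\mathcal U$ and $V\in\mathcal U^\perp$, has all its vertices in $\mathcal D'$. Proposition. Let $\mathcal G$ be a locally coherent Grothendieck category, let $\mathcal S$ be a set of finitely presented generators of $\mathcal G$, and let $(\mathcal U,\mathcal U^\perp[1])$ be a t-structure in $\mathcal D(\mathcal G)$ with heart $\mathcal H=\mathcal U\cap\mathcal U^\perp[1]$. Suppose that the following conditions hold: 1. $(\mathcal U,\mathcal U^\perp[1])$ restricts to $\mathcal D^b(\mathrm{fp}(\mathcal G))$; 2. there exist integers $m\le n$ such that $\mathcal D^{\le m}(\mathcal G)\subseteq\mathcal U\subseteq\mathcal D^{\le n}(\mathcal G)$; 3. $\mathcal H\cap\mathcal D^b(\mathrm{fp}(\mathcal G))$ is a class of generators of $\mathcal H$; 4. for each direct system $(M_i)_{i\in I}$ in $\mathcal H$, each $S\in\mathcal S$ and each $k\in\mathbb Z$, the canonical map $$\varinjlim\mathrm{Hom}_{\mathcal D(\mathcal G)}(S[k],M_i)\longrightarrow\mathrm{Hom}_{\mathcal D(\mathcal G)}\bigl(S[k],\textstyle\varinjlim_{\mathcal H}M_i\bigr)$$ is an isomorphism,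 where $\varinjlim_{\mathcal H}$ is the direct limit taken in $\mathcal H$. Then $\mathcal H$ is a locally coherent Grothendieck category, and its class of finitely presented objects is $\mathcal H\cap\mathcal D^b(\mathrm{fp}(\mathcal G))$. -/

import Mathlib

open CategoryTheory Limits Opposite Pretriangulated Triangulated

universe w v u

/-- `P` is a class of generators of `C`: every object of `C` is an epimorphic image of a coproduct
(indexed by a `w`-small set) of objects in `P`. -/
def IsGeneratingClass {C : Type*} [Category* C] (P : ObjectProperty C) : Prop :=
  ∀ X : C, ∃ (J : Type w) (F : J → C) (c : Cofan F) (_ : IsColimit c) (p : c.pt ⟶ X),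
    (∀ j, P (F j)) ∧ Epi p

/-- The full subcategory of the abelian category `A` given by `P` is an abelian exact subcategory:
it is closed under finite products and coproducts, kernels and cokernels in `A`. -/
structure IsAbelianExactSubcategory {A : Type*} [Category* A] [Abelian A]
    (P : ObjectProperty A) : Prop where
  finiteProducts : P.IsClosedUnderFiniteProducts
  finiteCoproducts : P.IsClosedUnderFiniteCoproducts
  kernels : P.IsClosedUnderKernels
  cokernels : P.IsClosedUnderCokernels

/-- `C` is a locally coherent Grothendieck category: it is a Grothendieck category with a set of
finitely presented generators (i.e. it is locally finitely presented), and its finitely presented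
objects form an abelian exact subcategory. All sizes are relative to the universe `w`. -/
structure IsLocallyCoherentGrothendieck (C : Type*) [Category* C] [Abelian C] : Prop where
  isGrothendieckAbelian : IsGrothendieckAbelian.{w} C
  exists_generators : ∃ S : ObjectProperty C, ObjectProperty.Small.{w} S ∧
    S ≤ ObjectProperty.isFinitelyPresentable.{w} C ∧ IsGeneratingClass.{w} S
  isAbelianExactSubcategory :
    IsAbelianExactSubcategory (ObjectProperty.isFinitelyPresentable.{w} C)

/-- The bounded derived category of finitely presented objects of `G`, viewed as a full subcategory
of the derived category of `G`: the homologically bounded complexes all of whose homology objects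
are finitely presented. -/
def boundedFP (G : Type u) [Category.{v} G] [Abelian G] [HasDerivedCategory.{w} G] :
    ObjectProperty (DerivedCategory G) := fun X =>
  (DerivedCategory.TStructure.t : TStructure (DerivedCategory G)).bounded X ∧
    ∀ i : ℤ, ObjectProperty.isFinitelyPresentable.{v} G
      ((DerivedCategory.homologyFunctor G i).obj X)

/-- The t-structure `t` restricts to the full triangulated subcategory given by `P`: each object of
`P` sits in a truncation triangle `U ⟶ X ⟶ V ⟶ U⟦1⟧`, with `U` in the aisle and `V` in the co-aisle,
all of whose vertices are in `P`. (The other axioms of a t-structure are inherited by `P`.) -/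
def TStructureRestrictsTo {D : Type*} [Category* D] [Preadditive D] [HasZeroObject D]
    [HasShift D ℤ] [∀ n : ℤ, (shiftFunctor D n).Additive] [Pretriangulated D]
    (t : TStructure D) (P : ObjectProperty D) : Prop :=
  ∀ X : D, P X → ∃ (U V : D) (f : U ⟶ X) (g : X ⟶ V) (h : V ⟶ U⟦(1 : ℤ)⟧),
    Triangle.mk f g h ∈ distTriang D ∧ t.le 0 U ∧ t.ge 1 V ∧ P U ∧ P V

/-! The central question is which objects `Y` of the derived category have `Hom(Y⟦k⟧, -)` commuting,
for all `k`, with a given filtered colimit of the heart. By the four lemma such `Y` form a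
triangulated subcategory (`ShiftedHomColimBijective`). Condition 4 places the generators `S` in it.
Since D^{≤m} ⊆ U bounds the heart uniformly below, descending induction on the shift reaches every
finitely presented object of `G`, and dévissage along homology reaches all of `boundedFP G`
(`shiftedHomColimBijective_of_boundedFP`). Hence the objects of the heart lying in `boundedFP G` are
finitely presented in the heart.

Exactness of filtered colimits has the same source. If K is the kernel of a filtered colimit of
monomorphisms, a chase through cones (`eq_zero_of_filtered_colimit_of_distTriang`) kills every map
from a shifted generator to K[1]; as K[1] is bounded below, such maps detect whether it is zero.
Coproducts in the heart are truncations of coproducts of complexes, whose universal property is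
needed only against bounded below targets, and these have K-injective resolutions. Since `boundedFP
G` is essentially small, condition 3 supplies a separator, and the heart is Grothendieck.

Kernels and cokernels in the heart are the two pieces of the truncation triangle of a cone, so
condition 1 makes the intersection of the heart with `boundedFP G` closed under both. An essentially
small generating class of finitely presented objects closed under finite colimits contains every
finitely presented object (`isFinitelyPresentable_le_of_isGeneratingClass`). The two classes
therefore coincide, and coherence follows. -/

set_option linter.unusedSectionVars false

/-! ### Morphisms into a filtered colimit -/

section HomColim

variable {C : Type*} [Category* C] {J : Type*} [Category* J]

/-- The canonical map `colim Hom(Y, F j) ⟶ Hom(Y, c.pt)` has trivial kernel. -/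
def HomColimInjective [HasZeroMorphisms C] {F : J ⥤ C} (c : Cocone F) : ObjectProperty C := fun Y =>
  ∀ ⦃j : J⦄ (g : Y ⟶ F.obj j), g ≫ c.ι.app j = 0 → ∃ (k : J) (u : j ⟶ k), g ≫ F.map u = 0

/-- The canonical map `colim Hom(Y, F j) ⟶ Hom(Y, c.pt)` is surjective. -/
def HomColimSurjective {F : J ⥤ C} (c : Cocone F) : ObjectProperty C := fun Y =>
  ∀ (g : Y ⟶ c.pt), ∃ (j : J) (g' : Y ⟶ F.obj j), g' ≫ c.ι.app j = g

variable {F : J ⥤ C} (c : Cocone F)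

instance [HasZeroMorphisms C] : (HomColimInjective c).IsClosedUnderIsomorphisms where
  of_iso {X Y} e h j g hg := by
    obtain ⟨k, u, hu⟩ := h (e.hom ≫ g) (by simp [hg])
    exact ⟨k, u, by rw [← cancel_epi e.hom, ← Category.assoc, hu, comp_zero]⟩

instance : (HomColimSurjective c).IsClosedUnderIsomorphisms where
  of_iso {X Y} e h g := by
    obtain ⟨j, g', hg⟩ := h (e.hom ≫ g)
    exact ⟨j, e.inv ≫ g', by rw [Category.assoc, hg, e.inv_hom_id_assoc]⟩

variable {c}

lemma HomColimInjective.exists_eq [Preadditive C] [IsFiltered J] {Y : C} (h : HomColimInjective c Y)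
    {i j : J} (g : Y ⟶ F.obj i) (g' : Y ⟶ F.obj j) (hg : g ≫ c.ι.app i = g' ≫ c.ι.app j) :
    ∃ (k : J) (u : i ⟶ k) (u' : j ⟶ k), g ≫ F.map u = g' ≫ F.map u' := by
  obtain ⟨k, a, ha⟩ := h (g ≫ F.map (IsFiltered.leftToMax i j) -
    g' ≫ F.map (IsFiltered.rightToMax i j)) (by simp [hg])
  refine ⟨k, IsFiltered.leftToMax i j ≫ a, IsFiltered.rightToMax i j ≫ a, ?_⟩
  rw [← sub_eq_zero]
  simpa [Preadditive.sub_comp] using ha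

lemma HomColimInjective.of_map {D : Type*} [Category* D] [HasZeroMorphisms C] [HasZeroMorphisms D]
    (Φ : C ⥤ D) [Φ.PreservesZeroMorphisms] [Φ.Full] [Φ.Faithful] {Y : C}
    (h : HomColimInjective c Y) :
    HomColimInjective (Φ.mapCocone c) (Φ.obj Y) := fun j g hg => by
  obtain ⟨g, rfl⟩ := Φ.map_surjective g
  obtain ⟨k, u, hu⟩ := h g (Φ.map_injective (by simpa using hg))
  exact ⟨k, u, by simpa using Φ.congr_map hu⟩

lemma HomColimSurjective.of_map {D : Type*} [Category* D]
    (Φ : C ⥤ D) [Φ.Full] {Y : C} (h : HomColimSurjective c Y) :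
    HomColimSurjective (Φ.mapCocone c) (Φ.obj Y) := fun g => by
  obtain ⟨g, rfl⟩ := Φ.map_surjective g
  obtain ⟨j, g', rfl⟩ := h g
  exact ⟨j, Φ.map g', by simp⟩

lemma homColim_of_isColimit_coyoneda [HasZeroMorphisms C] [IsFiltered J] {Y : C}
    (h : IsColimit ((coyoneda.obj (op Y)).mapCocone c)) :
    HomColimInjective c Y ∧ HomColimSurjective c Y := by
  refine ⟨fun j g hg => ?_, fun g => ?_⟩
  · obtain ⟨k, u, hu⟩ := (Types.FilteredColimit.isColimit_eq_iff' h g (0 : Y ⟶ F.obj j)).1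
      (by simpa using hg)
    exact ⟨k, u, by simpa using hu⟩
  · obtain ⟨j, g', hg'⟩ := Types.jointly_surjective_of_isColimit h g
    exact ⟨j, g', hg'⟩

lemma nonempty_isColimit_coyoneda [Preadditive C] [IsFiltered J] {Y : C}
    (h₁ : HomColimInjective c Y) (h₂ : HomColimSurjective c Y) :
    Nonempty (IsColimit ((coyoneda.obj (op Y)).mapCocone c)) := by
  refine ⟨Types.FilteredColimit.isColimitOf' _ _ (fun g => ?_)
    (fun j (x y : Y ⟶ F.obj j) hxy => ?_)⟩
  · obtain ⟨j, g', hg'⟩ := h₂ g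
    exact ⟨j, g', hg'.symm⟩
  · obtain ⟨k, u, hu⟩ := h₁ (x - y) (by
      rw [Preadditive.sub_comp, sub_eq_zero]
      exact hxy)
    refine ⟨k, u, ?_⟩
    rw [Preadditive.sub_comp, sub_eq_zero] at hu
    exact hu

end HomColim

/-! ### Filtered colimits and distinguished triangles -/

section Pretriangulated

variable {C : Type*} [Category* C] [Preadditive C] [HasZeroObject C] [HasShift C ℤ]
  [∀ n : ℤ, (shiftFunctor C n).Additive] [Pretriangulated C]
  {J : Type*} [Category* J] [IsFiltered J] {F : J ⥤ C} {c : Cocone F}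

section DistTriang

variable {X Y Z X' Y' Z' W : C} {f : X ⟶ Y} {g : Y ⟶ Z} {h : Z ⟶ X⟦(1 : ℤ)⟧}
  {f' : X' ⟶ Y'} {g' : Y' ⟶ Z'} {h' : Z' ⟶ X'⟦(1 : ℤ)⟧}

lemma distTriang_comp₁₂ (hT : Triangle.mk f g h ∈ distTriang C) : f ≫ g = 0 :=
  comp_distTriang_mor_zero₁₂ _ hT

lemma distTriang_comp₃₁ (hT : Triangle.mk f g h ∈ distTriang C) : h ≫ f⟦(1 : ℤ)⟧' = 0 :=
  comp_distTriang_mor_zero₃₁ _ hT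

lemma distTriang_rotate (hT : Triangle.mk f g h ∈ distTriang C) :
    Triangle.mk g h (-f⟦(1 : ℤ)⟧') ∈ distTriang C :=
  rot_of_distTriang _ hT

lemma distTriang_complete (hT : Triangle.mk f g h ∈ distTriang C)
    (hT' : Triangle.mk f' g' h' ∈ distTriang C) (a : X ⟶ X') (b : Y ⟶ Y')
    (w : f ≫ b = a ≫ f') :
    ∃ c : Z ⟶ Z', g ≫ c = b ≫ g' ∧ h ≫ a⟦(1 : ℤ)⟧' = c ≫ h' :=
  complete_distinguished_triangle_morphism _ _ hT hT' a b w

lemma distTriang_desc₂ (hT : Triangle.mk f g h ∈ distTriang C) (x : Y ⟶ W) (hx : f ≫ x = 0) :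
    ∃ y : Z ⟶ W, x = g ≫ y :=
  Triangle.yoneda_exact₂ _ hT x hx

lemma distTriang_desc₃ (hT : Triangle.mk f g h ∈ distTriang C) (x : Z ⟶ W) (hx : g ≫ x = 0) :
    ∃ y : X⟦(1 : ℤ)⟧ ⟶ W, x = h ≫ y :=
  Triangle.yoneda_exact₃ _ hT x hx

lemma distTriang_lift₂ (hT : Triangle.mk f g h ∈ distTriang C) (x : W ⟶ Y) (hx : x ≫ g = 0) :
    ∃ y : W ⟶ X, x = y ≫ f :=
  Triangle.coyoneda_exact₂ _ hT x hx

lemma distTriang_lift₃ (hT : Triangle.mk f g h ∈ distTriang C) (x : W ⟶ Z) (hx : x ≫ h = 0) :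
    ∃ y : W ⟶ Y, x = y ≫ g :=
  Triangle.coyoneda_exact₃ _ hT x hx

lemma distTriang_lift₁ (hT : Triangle.mk f g h ∈ distTriang C) (x : W ⟶ X⟦(1 : ℤ)⟧)
    (hx : x ≫ f⟦(1 : ℤ)⟧' = 0) :
    ∃ y : W ⟶ Z, x = y ≫ h :=
  Triangle.coyoneda_exact₁ _ hT x hx

/-- Four lemma for Hom(Y[1],-) → Hom(X[1],-) → Hom(Z,-) → Hom(Y,-). Injectivity and surjectivity are
kept apart because the later induction on shifts obtains them one after the other. -/
lemma HomColimInjective.of_distTriang (hT : Triangle.mk f g h ∈ distTriang C)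
    (h₁ : HomColimSurjective c (Y⟦(1 : ℤ)⟧)) (h₂ : HomColimInjective c (X⟦(1 : ℤ)⟧))
    (h₃ : HomColimInjective c Y) :
    HomColimInjective c Z := fun j z hz => by
  obtain ⟨k, u, hu⟩ := h₃ (g ≫ z) (by simp [hz])
  obtain ⟨x, hx⟩ := distTriang_desc₃ hT (z ≫ F.map u) (by simpa using hu)
  obtain ⟨y, hy⟩ := distTriang_desc₃ (distTriang_rotate hT) (x ≫ c.ι.app k) (by
    rw [← Category.assoc, ← hx]
    simp [hz])
  obtain ⟨l, y', rfl⟩ := h₁ y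
  obtain ⟨m, a, b, hab⟩ := h₂.exists_eq x ((-f⟦(1 : ℤ)⟧') ≫ y') (by rw [hy, Category.assoc])
  refine ⟨m, u ≫ a, ?_⟩
  rw [F.map_comp, ← Category.assoc, hx, Category.assoc, hab, Category.assoc,
    Preadditive.neg_comp, Preadditive.comp_neg, ← Category.assoc, distTriang_comp₃₁ hT,
    zero_comp, neg_zero]

/-- Four lemma for Hom(X[1],-) → Hom(Z,-) → Hom(Y,-) → Hom(X,-). -/
lemma HomColimSurjective.of_distTriang (hT : Triangle.mk f g h ∈ distTriang C)
    (h₁ : HomColimSurjective c (X⟦(1 : ℤ)⟧)) (h₂ : HomColimSurjective c Y)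
    (h₃ : HomColimInjective c X) :
    HomColimSurjective c Z := fun z => by
  obtain ⟨j, y, hy⟩ := h₂ (g ≫ z)
  have h₀ := distTriang_comp₁₂ hT
  obtain ⟨k, u, hu⟩ := h₃ (f ≫ y) (by rw [Category.assoc, hy, reassoc_of% h₀, zero_comp])
  obtain ⟨z', hz'⟩ := distTriang_desc₂ hT (y ≫ F.map u) (by simpa using hu)
  obtain ⟨x, hx⟩ := distTriang_desc₃ hT (z - (z' ≫ c.ι.app k : Z ⟶ c.pt)) (by
    rw [Preadditive.comp_sub, ← hy, ← Category.assoc, ← hz', Category.assoc, c.w, sub_self])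
  obtain ⟨l, x', rfl⟩ := h₁ x
  refine ⟨IsFiltered.max k l, z' ≫ F.map (IsFiltered.leftToMax k l) +
    h ≫ x' ≫ F.map (IsFiltered.rightToMax k l), ?_⟩
  rw [sub_eq_iff_eq_add] at hx
  simp [hx, add_comm]

end DistTriang

/-- `Hom(Y⟦n⟧, -)` commutes with the filtered colimit `c` for all integers `n`. -/
def ShiftedHomColimBijective (c : Cocone F) : ObjectProperty C := fun Y =>
  ∀ n : ℤ, HomColimInjective c (Y⟦n⟧) ∧ HomColimSurjective c (Y⟦n⟧)

instance : (ShiftedHomColimBijective c).IsClosedUnderIsomorphisms where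
  of_iso e h n := ⟨(HomColimInjective c).prop_of_iso ((shiftFunctor C n).mapIso e) (h n).1,
    (HomColimSurjective c).prop_of_iso ((shiftFunctor C n).mapIso e) (h n).2⟩

instance : (ShiftedHomColimBijective c).IsStableUnderShift ℤ where
  isStableUnderShiftBy n :=
    { le_shift := fun X h m => ⟨(HomColimInjective c).prop_of_iso
        ((shiftFunctorAdd' C n m _ rfl).app X) (h _).1, (HomColimSurjective c).prop_of_iso
        ((shiftFunctorAdd' C n m _ rfl).app X) (h _).2⟩ }

lemma ShiftedHomColimBijective.homColim {Y : C} (h : ShiftedHomColimBijective c Y) :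
    HomColimInjective c Y ∧ HomColimSurjective c Y :=
  ⟨(HomColimInjective c).prop_of_iso ((shiftFunctorZero C ℤ).app Y) (h 0).1,
   (HomColimSurjective c).prop_of_iso ((shiftFunctorZero C ℤ).app Y) (h 0).2⟩

lemma ShiftedHomColimBijective.shift_homColim {Y : C} (h : ShiftedHomColimBijective c Y) (n : ℤ) :
    HomColimInjective ((shiftFunctor C n).mapCocone c) Y ∧
      HomColimSurjective ((shiftFunctor C n).mapCocone c) Y :=
  ⟨(HomColimInjective _).prop_of_iso ((shiftEquiv' C (-n) n (by simp)).unitIso.symm.app Y)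
    ((h (-n)).1.of_map (shiftFunctor C n)),
   (HomColimSurjective _).prop_of_iso ((shiftEquiv' C (-n) n (by simp)).unitIso.symm.app Y)
    ((h (-n)).2.of_map (shiftFunctor C n))⟩

instance : (ShiftedHomColimBijective c).IsTriangulatedClosed₃ := .mk' (fun T hT h₁ h₂ n => by
  have hT' : Triangle.mk _ _ _ ∈ distTriang C := Triangle.shift_distinguished T hT n
  have h₁' := (ShiftedHomColimBijective c).le_shift n _ h₁
  have h₂' := (ShiftedHomColimBijective c).le_shift n _ h₂
  exact ⟨HomColimInjective.of_distTriang hT' (h₂' 1).2 (h₁' 1).1 h₂'.homColim.1,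
    HomColimSurjective.of_distTriang hT' (h₁' 1).2 h₂'.homColim.2 h₁'.homColim.1⟩)

instance : (ShiftedHomColimBijective c).IsTriangulatedClosed₂ := .of_isTriangulatedClosed₃

variable {A : Type*} [Category* A] [Preadditive A] (ι : A ⥤ C) [ι.Full] [ι.Faithful] [ι.Additive]

/-- The diagram chase showing that filtered colimits are exact in an abelian subcategory of a
triangulated category: `f : cM.pt ⟶ cN.pt` is a filtered colimit of morphisms `α j`
sitting in distinguished triangles `M j ⟶ N j ⟶ P j ⟶ (M j)⟦1⟧`, and `K⟦1⟧ ⟶ Z ⟶ Q` is the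
truncation triangle of the cone `Z` of `f`. -/
lemma eq_zero_of_filtered_colimit_of_distTriang
    {M N P : J ⥤ A} (α : M ⟶ N) (β : N ⟶ P) [∀ j, Epi (β.app j)]
    (δ : ∀ j, ι.obj (P.obj j) ⟶ (ι.obj (M.obj j))⟦(1 : ℤ)⟧)
    (hδ : ∀ j, Triangle.mk (ι.map (α.app j)) (ι.map (β.app j)) (δ j) ∈ distTriang C)
    (cM : Cocone M) (cN : Cocone N) (cP : Cocone P) (f : cM.pt ⟶ cN.pt) (g : cN.pt ⟶ cP.pt)
    (hf : ∀ j, cM.ι.app j ≫ f = α.app j ≫ cN.ι.app j)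
    (hg : ∀ j, cN.ι.app j ≫ g = β.app j ≫ cP.ι.app j)
    {Z : C} {f₂ : ι.obj cN.pt ⟶ Z} {f₃ : Z ⟶ (ι.obj cM.pt)⟦(1 : ℤ)⟧}
    (hZ : Triangle.mk (ι.map f) f₂ f₃ ∈ distTriang C)
    {K Q : A} {a : (ι.obj K)⟦(1 : ℤ)⟧ ⟶ Z} {b : Z ⟶ ι.obj Q}
    {γ : ι.obj Q ⟶ (ι.obj K)⟦(1 : ℤ)⟧⟦(1 : ℤ)⟧} (hK : Triangle.mk a b γ ∈ distTriang C)
    (e : Q ⟶ cP.pt) [IsIso e] (he : f₂ ≫ b ≫ ι.map e = ι.map g)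
    {s : C} (hM : ShiftedHomColimBijective (ι.mapCocone cM) s)
    (hN : ShiftedHomColimBijective (ι.mapCocone cN) s)
    (hP : ShiftedHomColimBijective (ι.mapCocone cP) s)
    (x : s ⟶ (ι.obj K)⟦(1 : ℤ)⟧) : x = 0 := by
  have epi {j : J} {Y : A} {y y' : ι.obj (P.obj j) ⟶ ι.obj Y}
      (h : ι.map (β.app j) ≫ y = ι.map (β.app j) ≫ y') : y = y' := by
    obtain ⟨y, rfl⟩ := ι.map_surjective y
    obtain ⟨y', rfl⟩ := ι.map_surjective y'
    rw [← ι.map_comp, ← ι.map_comp] at h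
    rw [(cancel_epi (β.app j)).1 (ι.map_injective h)]
  have mono {W : C} {y y' : W ⟶ ι.obj Q} (h : y ≫ ι.map e = y' ≫ ι.map e) : y = y' := by
    rwa [cancel_mono] at h
  -- The triangles are chosen independently for each index, so naturality of the connecting maps is
  -- not given. It holds because the third component of a morphism of triangles is forced here:
  -- `β.app j` is an epimorphism of `A`.
  have hδ_nat {j k : J} (u : j ⟶ k) :
      ι.map (P.map u) ≫ δ k = δ j ≫ (ι.map (M.map u))⟦(1 : ℤ)⟧' := by
    obtain ⟨θ, hθ₁, hθ₂⟩ := distTriang_complete (hδ j) (hδ k)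
      (ι.map (M.map u)) (ι.map (N.map u)) (by
        rw [← ι.map_comp, ← ι.map_comp, α.naturality])
    obtain rfl : θ = ι.map (P.map u) := epi (by rw [hθ₁, ← ι.map_comp, ← ι.map_comp, β.naturality])
    exact hθ₂.symm
  -- Comparison of the cone of `α.app j` with the cone `Z` of the colimit map. No compatibility of
  -- the maps `θ` for varying `j` is needed.
  have hθ (j : J) : ∃ θ : ι.obj (P.obj j) ⟶ Z, θ ≫ b ≫ ι.map e = ι.map (cP.ι.app j) ∧
      θ ≫ f₃ = δ j ≫ (ι.map (cM.ι.app j))⟦(1 : ℤ)⟧' := by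
    obtain ⟨θ, hθ₁, hθ₂⟩ := distTriang_complete (hδ j) hZ
      (ι.map (cM.ι.app j)) (ι.map (cN.ι.app j)) (by
        rw [← ι.map_comp, ← ι.map_comp, hf])
    refine ⟨θ, epi ?_, hθ₂.symm⟩
    rw [reassoc_of% hθ₁, he, ← ι.map_comp, ← ι.map_comp, hg]
  have hf' (j : J) := ι.congr_map (hf j)
  have hg' (j : J) := ι.congr_map (hg j)
  simp only [ι.map_comp] at hf' hg'
  have z₁ (j) : ι.map (β.app j) ≫ δ j = 0 := comp_distTriang_mor_zero₂₃ _ (hδ j)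
  have z₂ : a ≫ b = 0 := comp_distTriang_mor_zero₁₂ _ hK
  have z₃ : b ≫ γ = 0 := comp_distTriang_mor_zero₂₃ _ hK
  have z₄ : ι.map f ≫ f₂ = 0 := comp_distTriang_mor_zero₁₂ _ hZ
  have z₅ : f₃ ≫ (ι.map f)⟦(1 : ℤ)⟧' = 0 := comp_distTriang_mor_zero₃₁ _ hZ
  -- the image of `x` in `cM.pt⟦1⟧` vanishes
  have hy : x ≫ a ≫ f₃ = 0 := by
    obtain ⟨j, y, hy⟩ := (hM.shift_homColim 1).2 (x ≫ a ≫ f₃)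
    dsimp at y hy
    obtain ⟨k, u, hu⟩ := (hN.shift_homColim 1).1 (j := j) (y ≫ (ι.map (α.app j))⟦(1 : ℤ)⟧') (by
      dsimp
      rw [Category.assoc, ← Functor.map_comp, ← hf', Functor.map_comp, reassoc_of% hy, z₅]
      simp)
    dsimp at hu
    -- The lift `y` already dies in `N k`, so it comes from some `w` into `P k`. It remains to show
    -- that, further along, `w` comes from `N`, since the connecting map then kills it.
    obtain ⟨w, hw⟩ := distTriang_lift₁ (hδ k) (y ≫ (ι.map (M.map u))⟦(1 : ℤ)⟧') (by
      rw [Category.assoc, ← Functor.map_comp, ← ι.map_comp, α.naturality, ι.map_comp,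
        Functor.map_comp, ← Category.assoc, hu])
    obtain ⟨θ, hθ₁, hθ₂⟩ := hθ k
    have hy' : x ≫ a ≫ f₃ = w ≫ θ ≫ f₃ := by
      rw [hθ₂, ← reassoc_of% hw, ← hy, ← Functor.map_comp, ← ι.map_comp, cM.w]
    obtain ⟨n, hn⟩ := distTriang_lift₃ hZ (w ≫ θ - x ≫ a) (by
      rw [Preadditive.sub_comp, Category.assoc, Category.assoc, hy', sub_self])
    have hn' : w ≫ ι.map (cP.ι.app k) = n ≫ ι.map g := by
      rw [← hθ₁, ← he, ← reassoc_of% hn, Preadditive.sub_comp, Category.assoc, Category.assoc,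
        reassoc_of% z₂]
      simp
    obtain ⟨l, n, rfl⟩ := hN.homColim.2 n
    dsimp at n hn'
    rw [Category.assoc, ← ι.map_comp, hg, ι.map_comp] at hn'
    obtain ⟨m, p, q, hpq⟩ := hP.homColim.1.exists_eq w (n ≫ ι.map (β.app l)) (by
      simpa using hn')
    dsimp at hpq
    have : y ≫ (ι.map (M.map (u ≫ p)))⟦(1 : ℤ)⟧' = 0 := by
      rw [M.map_comp, ι.map_comp, Functor.map_comp, reassoc_of% hw, ← hδ_nat, reassoc_of% hpq,
        ← ι.map_comp_assoc, ← β.naturality, ι.map_comp_assoc, z₁, comp_zero, comp_zero]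
    rw [← hy, ← cM.w (u ≫ p), ι.map_comp, Functor.map_comp, reassoc_of% this, zero_comp]
  have hx : x ≫ a = 0 := by
    obtain ⟨n, hn⟩ := distTriang_lift₃ hZ (x ≫ a) (by rw [Category.assoc, hy])
    obtain ⟨l, n, rfl⟩ := hN.homColim.2 n
    dsimp at n hn
    have hn' : n ≫ ι.map (β.app l) ≫ ι.map (cP.ι.app l) = 0 := by
      rw [← hg', ← he, ← Category.assoc (ι.map _) f₂, ← Category.assoc n, ← Category.assoc n, ← hn]
      simp [reassoc_of% z₂]
    obtain ⟨m, u, hu⟩ := hP.homColim.1 (j := l) (n ≫ ι.map (β.app l)) (by simpa using hn')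
    dsimp at hu
    obtain ⟨r, hr⟩ := distTriang_lift₂ (hδ m) (n ≫ ι.map (N.map u)) (by
      rw [Category.assoc, ← ι.map_comp, β.naturality, ι.map_comp, ← Category.assoc, hu])
    rw [hn, ← cN.w u, ι.map_comp, reassoc_of% hr, ← hf', Category.assoc, Category.assoc, z₄]
    simp
  -- Now `x⟦1⟧` factors through `γ` by a map `q` to `Q`. Since `Q` is the colimit of `P`, `q` lifts
  -- to a stage `P j` and hence, via `θ`, factors through `b`; but `b ≫ γ = 0`.
  obtain ⟨q, hq⟩ := distTriang_lift₁ hK (x⟦(1 : ℤ)⟧') (by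
    rw [← Functor.map_comp, hx, Functor.map_zero])
  obtain ⟨j, p, hp⟩ := (hP 1).2 (q ≫ ι.map e)
  dsimp at p hp
  obtain ⟨θ, hθ₁, -⟩ := hθ j
  have : q = p ≫ θ ≫ b := mono (by simp [← hp, hθ₁])
  apply (shiftFunctor C (1 : ℤ)).map_injective
  rw [hq, this]
  simp [z₃]

end Pretriangulated

/-! ### Generating classes and finitely presented objects of an abelian category -/

section Generators

variable {C : Type*} [Category* C]

lemma IsGeneratingClass.mono {P Q : ObjectProperty C} (h : IsGeneratingClass.{w} P) (hPQ : P ≤ Q) :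
    IsGeneratingClass.{w} Q := fun X => by
  obtain ⟨J, F, c, hc, p, hF, hp⟩ := h X
  exact ⟨J, F, c, hc, p, fun j => hPQ _ (hF j), hp⟩

lemma IsGeneratingClass.of_le_isoClosure {P Q : ObjectProperty C} (h : IsGeneratingClass.{w} P)
    (hPQ : P ≤ Q.isoClosure) : IsGeneratingClass.{w} Q := fun X => by
  obtain ⟨J, F, c, hc, p, hF, hp⟩ := h X
  choose F' hF' e using fun j => hPQ _ (hF j)
  let i : Discrete.functor F' ≅ Discrete.functor F :=
    Discrete.natIso (fun j => (e j.as).some.symm)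
  exact ⟨J, F', (Cocone.precompose i.hom).obj c,
    (IsColimit.precomposeHomEquiv i c).symm hc, p, hF', hp⟩

lemma IsGeneratingClass.isStrongGenerator [Abelian C] {P : ObjectProperty C}
    (h : IsGeneratingClass.{w} P) : P.IsStrongGenerator :=
  .mk_of_exists_extremalEpi.{w} (fun X => by
    obtain ⟨J, F, c, hc, p, hF, hp⟩ := h X
    have : StrongEpi p := strongEpi_of_epi p
    exact ⟨J, F, hF, c, hc, p, inferInstance⟩)

end Generators

section FinitelyGenerated

variable {C : Type*} [Category* C] [Abelian C]

/-- The class of objects `X` such that the canonical maps `colim Hom(X, F j) ⟶ Hom(X, colim F)`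
are injective for all `w`-small filtered diagrams. -/
def filteredHomColimInjective : ObjectProperty C := fun X =>
  ∀ (J : Type w) [SmallCategory J] [IsFiltered J] (F : J ⥤ C) (c : Cocone F) (_ : IsColimit c),
    HomColimInjective c X

lemma filteredHomColimInjective_of_isFinitelyPresentable (X : C) [IsFinitelyPresentable.{w} X] :
    filteredHomColimInjective.{w} X := fun J _ _ F c hc =>
  (homColim_of_isColimit_coyoneda (isColimitOfPreserves (coyoneda.obj (op X)) hc)).1

lemma filteredHomColimInjective_of_shortExact {S : ShortComplex C} (hS : S.ShortExact)
    (h₁ : filteredHomColimInjective.{w} S.X₁) (h₃ : filteredHomColimInjective.{w} S.X₃) :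
    filteredHomColimInjective.{w} S.X₂ := fun J _ _ F c hc j g hg => by
  obtain ⟨k, u, hu⟩ := h₁ J F c hc (S.f ≫ g) (by simp [hg])
  have := hS.epi_g
  have hu' : S.f ≫ g ≫ F.map u = 0 := by simpa using hu
  obtain ⟨l, v, hv⟩ := h₃ J F c hc (hS.exact.desc (g ≫ F.map u) hu') (by
    rw [← cancel_epi S.g, hS.exact.g_desc_assoc]
    simp [hg])
  refine ⟨l, u ≫ v, ?_⟩
  rw [← cancel_epi S.g, hS.exact.g_desc_assoc] at hv
  simpa using hv

open CoproductsFromFiniteFiltered in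
-- The quotients of `B` by the images of the finite subcoproducts form a filtered diagram in which
-- the map from `B` to the colimit is zero, so it is zero at a finite stage. Only injectivity on `B`
-- enters, which is what an extension of finitely presented objects inherits directly.
lemma exists_epi_finite_coproduct [HasFilteredColimitsOfSize.{w, w} C] {B : C}
    (hB : filteredHomColimInjective.{w} B) {K : Type w} {X : K → C} {c : Cofan X}
    (hc : IsColimit c) (p : c.pt ⟶ B) [Epi p] :
    ∃ S : Finset (Discrete K), Epi (Sigma.desc (fun x : S => c.inj x.1.as ≫ p)) := by
  classical
  let τ : liftToFinsetObj (Discrete.functor X) ⟶ (Functor.const _).obj B :=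
    { app S := Sigma.desc (fun x : S => c.inj x.1.as ≫ p)
      naturality S T u := by
        apply Sigma.hom_ext
        intro x
        simp [liftToFinsetObj] }
  let Q := cokernel τ
  let π : (Functor.const _).obj B ⟶ Q := cokernel.π τ
  have hπ (S) : τ.app S ≫ π.app S = 0 := by
    rw [← NatTrans.comp_app, cokernel.condition]
    rfl
  have hπ' {S T} (u : S ⟶ T) : π.app S ≫ Q.map u = π.app T := by
    have := π.naturality u
    simpa using this.symm
  let d := colimit.cocone Q
  have h₀ : π.app ∅ ≫ d.ι.app ∅ = 0 := by
    rw [← cancel_epi p, comp_zero]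
    refine Cofan.IsColimit.hom_ext hc _ _ (fun k => ?_)
    let u : (∅ : Finset (Discrete K)) ⟶ {Discrete.mk k} := homOfLE (Finset.empty_subset _)
    obtain ⟨a, hk⟩ : ∃ a, c.inj k ≫ p = a ≫ τ.app {Discrete.mk k} :=
      ⟨Sigma.ι (fun x : ({Discrete.mk k} : Finset (Discrete K)) =>
        (Discrete.functor X).obj x) ⟨Discrete.mk k, by simp⟩, by simp [τ, liftToFinsetObj]⟩
    rw [comp_zero, ← d.w u, reassoc_of% (hπ' u), reassoc_of% hk, reassoc_of% (hπ _)]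
    simp
  obtain ⟨S, u, hu⟩ := hB _ Q d (colimit.isColimit Q) (j := ∅) (π.app ∅) h₀
  rw [hπ'] at hu
  refine ⟨S, ?_⟩
  have hS : (ShortComplex.mk (τ.app S) (π.app S) (hπ S)).Exact :=
    ((ShortComplex.exact_cokernel τ).map ((evaluation _ _).obj S) :)
  exact hS.epi_f hu

end FinitelyGenerated

section FinitelyPresented

variable {C : Type*} [Category* C] [Abelian C]

namespace IsLocallyCoherentGrothendieck

open ObjectProperty

variable (hC : IsLocallyCoherentGrothendieck.{w} C)

include hC

lemma isGeneratingClass : IsGeneratingClass.{w} (isFinitelyPresentable.{w} C) := by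
  obtain ⟨S, _, hS, hS'⟩ := hC.exists_generators
  exact hS'.mono hS

lemma essentiallySmall_isFinitelyPresentable :
    ObjectProperty.EssentiallySmall.{w} (isFinitelyPresentable.{w} C) := by
  have := hC.isGrothendieckAbelian
  obtain ⟨S, _, hS, hS'⟩ := hC.exists_generators
  have : Fact Cardinal.aleph0.{w}.IsRegular := Cardinal.fact_isRegular_aleph0
  have : IsLocallyFinitelyPresentable.{w} C :=
    (IsCardinalLocallyPresentable.iff_exists_isStrongGenerator C Cardinal.aleph0).2
      ⟨S, inferInstance, hS'.isStrongGenerator, hS⟩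
  infer_instance

lemma exists_epi_of_isGeneratingClass {S : ObjectProperty C} (hS : IsGeneratingClass.{w} S)
    {B : C} (hB : filteredHomColimInjective.{w} B) :
    ∃ (J : Type w) (_ : Finite J) (F : J → C) (c : Cofan F) (_ : IsColimit c) (p : c.pt ⟶ B),
      (∀ j, S (F j)) ∧ Epi p := by
  have := hC.isGrothendieckAbelian
  obtain ⟨J, F, c, hc, p, hF, _⟩ := hS B
  obtain ⟨T, hT⟩ := exists_epi_finite_coproduct hB hc p
  exact ⟨T, inferInstance, _, _, coproductIsCoproduct _, _, fun x => hF _, hT⟩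

/-- Cover the middle term by a finitely presented `c.pt`. The kernel of the cover is also the kernel
of the induced map from `kernel (p ≫ S.g)` to `S.X₁`, hence finitely presented by coherence, and the
middle term is a cokernel of finitely presented objects. -/
lemma isClosedUnderExtensions : (isFinitelyPresentable.{w} C).IsClosedUnderExtensions where
  prop_X₂_of_shortExact {S} hS h₁ h₃ := by
    have := hC.isAbelianExactSubcategory.kernels
    have := hC.isAbelianExactSubcategory.cokernels
    have := hC.isAbelianExactSubcategory.finiteCoproducts
    have : IsFinitelyPresentable.{w} S.X₁ := h₁
    have : IsFinitelyPresentable.{w} S.X₃ := h₃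
    obtain ⟨J, _, F, c, hc, p, hF, _⟩ := hC.exists_epi_of_isGeneratingClass hC.isGeneratingClass
      (filteredHomColimInjective_of_shortExact hS
        (filteredHomColimInjective_of_isFinitelyPresentable S.X₁)
        (filteredHomColimInjective_of_isFinitelyPresentable S.X₃))
    have hP : isFinitelyPresentable.{w} C c.pt :=
      (isFinitelyPresentable.{w} C).prop_of_isColimit hc (fun j => hF _)
    have := hS.mono_f
    have := hS.epi_g
    let K := kernel (p ≫ S.g)
    have hK : isFinitelyPresentable.{w} C K := prop_kernel _ _ hP h₃
    let l : K ⟶ S.X₁ := hS.exact.lift (kernel.ι (p ≫ S.g) ≫ p) (by simp [K])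
    have hl : l ≫ S.f = kernel.ι (p ≫ S.g) ≫ p := hS.exact.lift_f _ _
    have hL : isFinitelyPresentable.{w} C (kernel l) := prop_kernel _ _ hK h₁
    let k : kernel l ⟶ c.pt := kernel.ι l ≫ kernel.ι (p ≫ S.g)
    have hk : k ≫ p = 0 := by simp [k, ← hl]
    have hk' : (ShortComplex.mk k p hk).Exact := by
      rw [ShortComplex.exact_iff_exact_up_to_refinements]
      intro A x hx
      dsimp at x hx
      refine ⟨A, 𝟙 A, inferInstance, kernel.lift l (kernel.lift _ x (by rw [reassoc_of% hx, zero_comp])) ?_, ?_⟩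
      · rw [← cancel_mono S.f, Category.assoc, hl]
        simp [hx]
      · simp [k]
    exact prop_of_isColimit_cokernelCofork _ hk'.gIsCokernel hL hP

end IsLocallyCoherentGrothendieck

/-- `X₃` is an extension of the kernel of `f₄` by the cokernel of `f₁`. -/
lemma ObjectProperty.prop_X₃_of_exact (P : ObjectProperty C) [P.IsClosedUnderKernels]
    [P.IsClosedUnderCokernels] [P.IsClosedUnderExtensions]
    {X₁ X₂ X₃ X₄ X₅ : C} {f₁ : X₁ ⟶ X₂} {f₂ : X₂ ⟶ X₃} {f₃ : X₃ ⟶ X₄} {f₄ : X₄ ⟶ X₅}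
    {w₁ : f₁ ≫ f₂ = 0} {w₂ : f₂ ≫ f₃ = 0} {w₃ : f₃ ≫ f₄ = 0}
    (e₁ : (ShortComplex.mk f₁ f₂ w₁).Exact) (e₂ : (ShortComplex.mk f₂ f₃ w₂).Exact)
    (e₃ : (ShortComplex.mk f₃ f₄ w₃).Exact) (h₁ : P X₁) (h₂ : P X₂) (h₄ : P X₄) (h₅ : P X₅) :
    P X₃ := by
  let S := ShortComplex.mk (cokernel.desc f₁ f₂ w₁) (kernel.lift f₄ f₃ w₃) (by
    rw [← cancel_epi (cokernel.π f₁), ← cancel_mono (kernel.ι f₄)]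
    simp [w₂])
  have : Mono S.f := e₁.mono_cokernelDesc
  have : Epi S.g := e₃.epi_kernelLift
  have hS : S.Exact := by
    rw [ShortComplex.exact_iff_exact_up_to_refinements] at e₂ ⊢
    intro A x hx
    dsimp [S] at x hx
    obtain ⟨A', π, _, y, hy⟩ := e₂ x (by simpa using hx =≫ kernel.ι f₄)
    exact ⟨A', π, inferInstance, y ≫ cokernel.π f₁, by simpa [S] using hy⟩
  exact P.prop_X₂_of_shortExact (ShortComplex.ShortExact.mk hS) (P.prop_cokernel _ h₁ h₂)
    (P.prop_kernel _ h₄ h₅)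

end FinitelyPresented

/-! ### Smallness of Hom sets and of extensions in triangulated categories -/

section Pretriangulated

variable {C : Type*} [Category* C] [Preadditive C] [HasZeroObject C] [HasShift C ℤ]
  [∀ n : ℤ, (shiftFunctor C n).Additive] [Pretriangulated C]

section

variable {X Y Z W : C} {f : X ⟶ Y} {g : Y ⟶ Z} {h : Z ⟶ X⟦(1 : ℤ)⟧}

lemma distTriang_of_iso (hT : Triangle.mk f g h ∈ distTriang C) {X' Y' Z' : C} {f' : X' ⟶ Y'}
    {g' : Y' ⟶ Z'} {h' : Z' ⟶ X'⟦(1 : ℤ)⟧} (eX : X' ≅ X) (eY : Y' ≅ Y) (eZ : Z' ≅ Z)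
    (hf : f' ≫ eY.hom = eX.hom ≫ f) (hg : g' ≫ eZ.hom = eY.hom ≫ g)
    (hh : h' ≫ eX.hom⟦(1 : ℤ)⟧' = eZ.hom ≫ h) :
    Triangle.mk f' g' h' ∈ distTriang C :=
  isomorphic_distinguished _ hT _ (Triangle.isoMk _ _ eX eY eZ hf hg hh)

lemma distTriang_nonempty_iso₂ (hT : Triangle.mk f g h ∈ distTriang C) {Y' : C} {f' : X ⟶ Y'}
    {g' : Y' ⟶ Z} (hT' : Triangle.mk f' g' h ∈ distTriang C) : Nonempty (Y ≅ Y') := by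
  have hh : h ≫ (𝟙 X)⟦(1 : ℤ)⟧' = 𝟙 Z ≫ h := by simp
  obtain ⟨φ : Y ⟶ Y', hφ₁, hφ₂⟩ :=
    complete_distinguished_triangle_morphism₂ _ _ hT hT' (𝟙 X) (𝟙 Z) hh
  have : IsIso φ := isIso₂_of_isIso₁₃ (Triangle.homMk (Triangle.mk f g h) (Triangle.mk f' g' h)
    (𝟙 X) φ (𝟙 Z) hφ₁ hφ₂ hh) hT hT' (inferInstanceAs (IsIso (𝟙 X))) (inferInstanceAs (IsIso (𝟙 Z)))
  exact ⟨asIso φ⟩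

/-- After choosing for each restriction to `X` one extension to `Y`, any map from `Y` differs from
the chosen one by a map factoring through `Z`. -/
lemma distTriang_small_hom_from (hT : Triangle.mk f g h ∈ distTriang C)
    [Small.{v} (X ⟶ W)] [Small.{v} (Z ⟶ W)] : Small.{v} (Y ⟶ W) := by
  classical
  let s (x : X ⟶ W) : Y ⟶ W := if hx : ∃ y, f ≫ y = x then hx.choose else 0
  refine small_of_surjective (α := (Z ⟶ W) × (X ⟶ W)) (f := fun p => g ≫ p.1 + s p.2) (fun y => ?_)
  have hs : f ≫ s (f ≫ y) = f ≫ y := by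
    have hx : ∃ y', f ≫ y' = f ≫ y := ⟨y, rfl⟩
    rw [show s (f ≫ y) = hx.choose from dif_pos hx]
    exact hx.choose_spec
  obtain ⟨z, hz⟩ := distTriang_desc₂ hT (y - s (f ≫ y)) (by rw [Preadditive.comp_sub, hs, sub_self])
  exact ⟨⟨z, f ≫ y⟩, by simp [← hz]⟩

lemma distTriang_small_hom_to (hT : Triangle.mk f g h ∈ distTriang C)
    [Small.{v} (W ⟶ X)] [Small.{v} (W ⟶ Z)] : Small.{v} (W ⟶ Y) := by
  classical
  let s (x : W ⟶ Z) : W ⟶ Y := if hx : ∃ y, y ≫ g = x then hx.choose else 0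
  refine small_of_surjective (α := (W ⟶ X) × (W ⟶ Z)) (f := fun p => p.1 ≫ f + s p.2) (fun y => ?_)
  have hs : s (y ≫ g) ≫ g = y ≫ g := by
    have hx : ∃ y', y' ≫ g = y ≫ g := ⟨y, rfl⟩
    rw [show s (y ≫ g) = hx.choose from dif_pos hx]
    exact hx.choose_spec
  obtain ⟨z, hz⟩ := distTriang_lift₂ hT (y - s (y ≫ g)) (by rw [Preadditive.sub_comp, hs, sub_self])
  exact ⟨⟨z, y ≫ g⟩, by simp [← hz]⟩

end

/-- An extension is determined up to isomorphism by its two ends and the connecting map. -/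
lemma ObjectProperty.essentiallySmall_extensionProduct {P Q : ObjectProperty C}
    [ObjectProperty.EssentiallySmall.{w} P] [ObjectProperty.EssentiallySmall.{w} Q]
    (h : ∀ ⦃X Z : C⦄, P X → Q Z → Small.{w} (Z ⟶ X⟦(1 : ℤ)⟧)) :
    ObjectProperty.EssentiallySmall.{w} (P.extensionProduct Q) := by
  obtain ⟨P₀, _, hP₀, hP⟩ := ObjectProperty.EssentiallySmall.exists_small_le.{w} P
  obtain ⟨Q₀, _, hQ₀, hQ⟩ := ObjectProperty.EssentiallySmall.exists_small_le.{w} Q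
  have (p : Subtype P₀ × Subtype Q₀) : Small.{w} (p.2.1 ⟶ p.1.1⟦(1 : ℤ)⟧) :=
    h (hP₀ _ p.1.2) (hQ₀ _ p.2.2)
  choose Y a b hT using fun (p : Σ (p : Subtype P₀ × Subtype Q₀), (p.2.1 ⟶ p.1.1⟦(1 : ℤ)⟧)) =>
    distinguished_cocone_triangle₂ p.2
  refine ⟨.ofObj Y, inferInstance, ?_⟩
  refine (P.monotone_extensionProduct_right hQ).trans ?_
  rw [ObjectProperty.extensionProduct_isoClosure_right]
  refine (ObjectProperty.monotone_extensionProduct_left Q₀ hP).trans ?_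
  rw [ObjectProperty.extensionProduct_isoClosure_left]
  rintro X ⟨X₁, X₃, f, g, δ, hX, h₁, h₃⟩
  exact ⟨_, ObjectProperty.ofObj_apply Y _,
    distTriang_nonempty_iso₂ hX (hT ⟨⟨⟨X₁, h₁⟩, ⟨X₃, h₃⟩⟩, δ⟩)⟩

end Pretriangulated

/-! ### Dévissage of bounded complexes along homology -/

namespace DerivedCategory

open ZeroObject

variable {G : Type u} [Category.{v} G] [Abelian G] [HasDerivedCategory.{w} G]

section

variable {X Y Z : DerivedCategory G} {f : X ⟶ Y} {g : Y ⟶ Z} {h : Z ⟶ X⟦(1 : ℤ)⟧}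

lemma isIso_homologyMap_mor₁ (hT : Triangle.mk f g h ∈ distTriang _) (i : ℤ)
    (h₁ : IsZero ((homologyFunctor G (i - 1)).obj Z)) (h₂ : IsZero ((homologyFunctor G i).obj Z)) :
    IsIso ((homologyFunctor G i).map f) := by
  have : Mono ((homologyFunctor G i).map f) :=
    (HomologySequence.mono_homologyMap_mor₁_iff _ hT (i - 1) i).2 (h₁.eq_of_src _ _)
  have : Epi ((homologyFunctor G i).map f) :=
    (HomologySequence.epi_homologyMap_mor₁_iff _ hT i).2 (h₂.eq_of_tgt _ _)
  exact isIso_of_mono_of_epi _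

lemma isIso_homologyMap_mor₂ (hT : Triangle.mk f g h ∈ distTriang _) (i : ℤ)
    (h₁ : IsZero ((homologyFunctor G i).obj X))
    (h₂ : IsZero ((homologyFunctor G (i + 1)).obj X)) :
    IsIso ((homologyFunctor G i).map g) := by
  have : Mono ((homologyFunctor G i).map g) :=
    (HomologySequence.mono_homologyMap_mor₂_iff _ hT i).2 (h₁.eq_of_src _ _)
  have : Epi ((homologyFunctor G i).map g) :=
    (HomologySequence.epi_homologyMap_mor₂_iff _ hT i (i + 1)).2 (h₂.eq_of_tgt _ _)
  exact isIso_of_mono_of_epi _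

end

/-- The property that all the homology objects satisfy `R`. -/
def homologyProperty (R : ObjectProperty G) : ObjectProperty (DerivedCategory G) :=
  fun X => ∀ i : ℤ, R ((homologyFunctor G i).obj X)

variable (R : ObjectProperty G)

instance [R.IsClosedUnderIsomorphisms] : (homologyProperty R).IsClosedUnderIsomorphisms where
  of_iso e h i := R.prop_of_iso ((homologyFunctor G i).mapIso e) (h i)

instance [R.IsClosedUnderIsomorphisms] : (homologyProperty R).IsStableUnderShift ℤ where
  isStableUnderShiftBy n :=
    { le_shift X hX i := R.prop_of_iso
        (((homologyFunctor G 0).shiftIso n i (n + i) rfl).symm.app X) (hX (n + i)) }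

instance [R.ContainsZero] [R.IsClosedUnderIsomorphisms] : (homologyProperty R).ContainsZero where
  exists_zero := ⟨0, isZero_zero _, fun i => R.prop_of_isZero
    ((homologyFunctor G i).map_isZero (isZero_zero _))⟩

instance [R.ContainsZero] [R.IsClosedUnderKernels] [R.IsClosedUnderCokernels]
    [R.IsClosedUnderExtensions] [R.IsClosedUnderIsomorphisms] :
    (homologyProperty R).IsTriangulated where
  toIsTriangulatedClosed₂ := by
    have : (homologyProperty R).IsTriangulatedClosed₃ := .mk' (fun T hT h₁ h₂ i =>
      ObjectProperty.prop_X₃_of_exact R (HomologySequence.exact₂ T hT i) (HomologySequence.exact₃ T hT i (i + 1))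
        (HomologySequence.exact₁ T hT i (i + 1)) (h₁ i) (h₂ i) (h₁ (i + 1)) (h₂ (i + 1)))
    exact .of_isTriangulatedClosed₃

/-- Homologically bounded complexes are obtained by successive extensions from their
homology objects. -/
lemma exists_distTriang_of_isGE_of_isLE (X : DerivedCategory G) (a b c : ℤ) (hbc : b + 1 = c)
    [X.IsGE a] [X.IsLE c] (hac : a ≤ c) (hX : homologyProperty R X) [R.IsClosedUnderIsomorphisms] 
    [R.ContainsZero] :
    ∃ (X' : DerivedCategory G) (A : G) (f : X' ⟶ X) (g : X ⟶ (singleFunctor G c).obj A)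
      (h : (singleFunctor G c).obj A ⟶ X'⟦(1 : ℤ)⟧) (_ : Triangle.mk f g h ∈ distTriang _),
      X'.IsGE a ∧ X'.IsLE b ∧ homologyProperty R X' ∧ R A := by
  obtain ⟨X', X'', hX', hX'', f, g, h, hT⟩ := TStructure.t.exists_triangle X b c hbc
  replace hX' : X'.IsLE b := ⟨hX'⟩
  replace hX'' : X''.IsGE c := ⟨hX''⟩
  have e' (i : ℤ) (hi : i < c) : (homologyFunctor G i).obj X' ≅ (homologyFunctor G i).obj X :=
    have := isIso_homologyMap_mor₁ hT i (isZero_of_isGE X'' c _ (by lia))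
      (isZero_of_isGE X'' c _ hi)
    asIso ((homologyFunctor G i).map f)
  have e'' (i : ℤ) (hi : b < i) : (homologyFunctor G i).obj X ≅ (homologyFunctor G i).obj X'' :=
    have := isIso_homologyMap_mor₂ hT i (isZero_of_isLE X' b _ (by lia))
      (isZero_of_isLE X' b _ (by lia))
    asIso ((homologyFunctor G i).map g)
  have : X''.IsLE c := (isLE_iff _ _).2 (fun i hi =>
    (isZero_of_isLE X c i hi).of_iso (e'' i (by lia)).symm)
  obtain ⟨A, ⟨e⟩⟩ := exists_iso_singleFunctor_obj_of_isGE_of_isLE X'' c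
  refine ⟨X', A, f, g ≫ e.hom, e.inv ≫ h, distTriang_of_iso hT (Iso.refl _) (Iso.refl _) e.symm
      (by simp) (by simp) (by simp),
    (isGE_iff _ _).2 (fun i hi => ?_), hX', fun i => ?_, ?_⟩
  · exact (isZero_of_isGE X a i hi).of_iso (e' i (by lia))
  · by_cases hi : i < c
    · exact R.prop_of_iso (e' i hi).symm (hX i)
    · exact R.prop_of_isZero (isZero_of_isLE X' b i (by lia))
  · exact R.prop_of_iso (e'' c (by lia) ≪≫ (homologyFunctor G c).mapIso e ≪≫
      (singleFunctorCompHomologyFunctorIso G c).app A) (hX c)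

lemma bounded_singleFunctor_obj (A : G) (n : ℤ) :
    TStructure.t.bounded ((singleFunctor G n).obj A) :=
  ⟨⟨n, inferInstance⟩, ⟨n, inferInstance⟩⟩

lemma prop_of_isGE_of_isLE [R.IsClosedUnderIsomorphisms] [R.ContainsZero]
    (W : ObjectProperty (DerivedCategory G)) [W.IsClosedUnderIsomorphisms]
    [W.IsTriangulatedClosed₂] (hW : ∀ (A : G) (n : ℤ), R A → W ((singleFunctor G n).obj A))
    (X : DerivedCategory G) (a b : ℤ) [X.IsGE a] (hX' : X.IsLE b) (hX : homologyProperty R X) :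
    W X := by
  -- `k` bounds the number of degrees that can carry homology. For `k = 0` the complex is zero, and
  -- each step splits off the top homology object.
  obtain ⟨k, hk⟩ : ∃ k : ℕ, b + 1 ≤ a + k := ⟨(b + 1 - a).toNat, by lia⟩
  have : X.IsLE (a + k - 1) := TStructure.t.isLE_of_le X b _
  clear hX' hk
  induction k generalizing X with
  | zero =>
    obtain ⟨Z, hZ, hZ'⟩ := R.exists_prop_of_containsZero
    have hX : IsZero X := TStructure.t.isZero X (a + (0 : ℕ) - 1) a
    exact W.prop_of_iso (((singleFunctor G 0).map_isZero hZ).iso hX) (hW Z 0 hZ')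
  | succ k hk =>
    obtain ⟨X', A, f, g, h, hT, _, _, hX', hA⟩ :=
      exists_distTriang_of_isGE_of_isLE R X a (a + k - 1) (a + (k + 1 : ℕ) - 1) (by lia)
        (by lia) hX
    have : X'.IsLE (a + k - 1) := by assumption
    exact W.ext_of_isTriangulatedClosed₂ _ hT (hk X' hX' this) (hW A _ hA)

lemma prop_of_bounded [R.IsClosedUnderIsomorphisms] [R.ContainsZero]
    (W : ObjectProperty (DerivedCategory G)) [W.IsClosedUnderIsomorphisms]
    [W.IsTriangulatedClosed₂] (hW : ∀ (A : G) (n : ℤ), R A → W ((singleFunctor G n).obj A))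
    {X : DerivedCategory G} (hX : TStructure.t.bounded X) (hX' : homologyProperty R X) : W X := by
  obtain ⟨⟨a, _⟩, ⟨b, _⟩⟩ := hX
  exact prop_of_isGE_of_isLE R W hW X a b inferInstance hX'

/-- Dévissage in each variable reduces to maps between shifted objects of `G`, that is to Ext
groups, which are small in a Grothendieck category. -/
lemma small_hom_of_bounded [IsGrothendieckAbelian.{v} G] {X Y : DerivedCategory G}
    (hX : TStructure.t.bounded X) (hY : TStructure.t.bounded Y) : Small.{v} (X ⟶ Y) := by
  have := IsGrothendieckAbelian.hasExt G
  let W₁ (Y : DerivedCategory G) : ObjectProperty (DerivedCategory G) := fun X => Small.{v} (X ⟶ Y)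
  have hW₁ (Y) : (W₁ Y).IsClosedUnderIsomorphisms :=
    ⟨fun e h => (small_congr (e.homCongr (Iso.refl _))).1 h⟩
  have hW₁' (Y) : (W₁ Y).IsTriangulatedClosed₂ := .mk' (fun T hT h₁ h₃ => by
    have : Small.{v} (T.obj₁ ⟶ Y) := h₁
    have : Small.{v} (T.obj₃ ⟶ Y) := h₃
    exact distTriang_small_hom_from (f := T.mor₁) (g := T.mor₂) (h := T.mor₃) hT)
  refine prop_of_bounded ⊤ (W₁ Y) (fun A n _ => ?_) hX (fun _ => trivial)
  let W₂ : ObjectProperty (DerivedCategory G) :=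
    fun Y => Small.{v} ((singleFunctor G n).obj A ⟶ Y)
  have : W₂.IsClosedUnderIsomorphisms :=
    ⟨fun e h => (small_congr ((Iso.refl _).homCongr e)).1 h⟩
  have : W₂.IsTriangulatedClosed₂ := .mk' (fun T hT h₁ h₃ => by
    have : Small.{v} ((singleFunctor G n).obj A ⟶ T.obj₁) := h₁
    have : Small.{v} ((singleFunctor G n).obj A ⟶ T.obj₃) := h₃
    exact distTriang_small_hom_to (f := T.mor₁) (g := T.mor₂) (h := T.mor₃) hT)
  exact prop_of_bounded ⊤ W₂ (fun B m _ => inferInstanceAs (Small.{v} (_ ⟶ _))) hY (fun _ => trivial)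

/-- Complexes with homology in a fixed interval are iterated extensions of stalk complexes, and
there are only countably many intervals. -/
lemma essentiallySmall_bounded_homologyProperty [IsGrothendieckAbelian.{v} G]
    [ObjectProperty.EssentiallySmall.{v} R] [R.IsClosedUnderIsomorphisms] [R.ContainsZero] :
    ObjectProperty.EssentiallySmall.{v} (TStructure.t.bounded ⊓ homologyProperty R) := by
  let P (a : ℤ) (k : ℕ) : ObjectProperty (DerivedCategory G) :=
    fun X => X.IsGE a ∧ X.IsLE (a + k - 1) ∧ homologyProperty R X
  have hP (a : ℤ) (k : ℕ) : ObjectProperty.EssentiallySmall.{v} (P a k) := by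
    induction k with
    | zero =>
      refine ⟨ObjectProperty.ofObj (fun (_ : PUnit) => 0), inferInstance, ?_⟩
      rintro X ⟨_, _, _⟩
      have hX : IsZero X := TStructure.t.isZero X (a + (0 : ℕ) - 1) a
      exact ⟨_, ObjectProperty.ofObj_apply _ PUnit.unit, ⟨hX.isoZero⟩⟩
    | succ k hk =>
      have := ObjectProperty.essentiallySmall_extensionProduct (P := P a k)
        (Q := R.map (singleFunctor G (a + (k + 1 : ℕ) - 1))) (by
          rintro X Z ⟨h₁, h₂, _⟩ ⟨A, _, ⟨e⟩⟩
          refine small_hom_of_bounded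
            (TStructure.t.bounded.prop_of_iso e (bounded_singleFunctor_obj A _))
            (TStructure.t.bounded.le_shift (1 : ℤ) X ⟨⟨_, h₁⟩, ⟨_, h₂⟩⟩))
      refine .of_le (Q := (P a k).extensionProduct (R.map (singleFunctor G (a + (k + 1 : ℕ) - 1)))) ?_
      rintro X ⟨_, _, hX⟩
      obtain ⟨X', A, f, g, h, hT, h₁, h₂, hX', hA⟩ :=
        exists_distTriang_of_isGE_of_isLE R X a (a + k - 1) (a + (k + 1 : ℕ) - 1) (by lia)
          (by lia) hX
      exact ⟨X', _, f, g, h, hT, ⟨h₁, h₂, hX'⟩, R.prop_map_obj _ hA⟩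
  refine .of_le (Q := ⨆ a, ⨆ k, P a k) ?_
  rintro X ⟨⟨⟨a, _⟩, ⟨b, _⟩⟩, hX⟩
  simp only [iSup_apply, iSup_Prop_eq]
  exact ⟨a, (b + 1 - a).toNat, inferInstance, TStructure.t.isLE_of_le X b _, hX⟩

end DerivedCategory

lemma ObjectProperty.isClosedUnderFiniteCoproducts_of_isClosedUnderFiniteProducts {C : Type*}
    [Category* C] [HasZeroMorphisms C] [HasFiniteBiproducts C] (P : ObjectProperty C)
    [P.IsClosedUnderFiniteProducts] : P.IsClosedUnderFiniteCoproducts where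
  isClosedUnderColimitsOfShape J _ := ⟨fun X ⟨h⟩ => by
    classical
    let F : J → C := fun j => h.diag.obj ⟨j⟩
    let i : h.diag ≅ Discrete.functor F := Discrete.natIso (fun _ => Iso.refl _)
    let c : Cofan F := (Cocone.precompose i.inv).obj (.mk X h.ι)
    have hc : IsColimit c := (IsColimit.precomposeInvEquiv i _).symm h.isColimit
    have : ⨁ F ≅ c.pt := IsColimit.coconePointUniqueUpToIso (biproduct.isColimit F) hc
    exact P.prop_of_isLimit_fan (f := F) (IsLimit.ofIsoLimit (biproduct.isLimit F)
      (Fan.ext this (by simp) : _ ≅ Fan.mk c.pt (fun j => this.inv ≫ biproduct.π F j)))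
      (fun j => h.prop_diag_obj _)⟩

instance isClosedUnderIsomorphisms_isFinitelyPresentable {C : Type*} [Category* C] :
    (ObjectProperty.isFinitelyPresentable.{w} C).IsClosedUnderIsomorphisms :=
  have : Fact Cardinal.aleph0.{w}.IsRegular := Cardinal.fact_isRegular_aleph0
  inferInstanceAs (isCardinalPresentable C Cardinal.aleph0.{w}).IsClosedUnderIsomorphisms

/-! ### Bounded complexes with finitely presented homology -/

section BoundedFP

open ZeroObject

variable {G : Type u} [Category.{v} G] [Abelian G] [HasDerivedCategory.{w} G]

open ObjectProperty DerivedCategory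

instance : (boundedFP G).IsClosedUnderIsomorphisms :=
  inferInstanceAs (TStructure.t.bounded ⊓
    homologyProperty (isFinitelyPresentable.{v} G)).IsClosedUnderIsomorphisms

lemma IsLocallyCoherentGrothendieck.containsZero {C : Type*} [Category* C] [Abelian C]
    (hC : IsLocallyCoherentGrothendieck.{w} C) : (isFinitelyPresentable.{w} C).ContainsZero := by
  have := hC.isAbelianExactSubcategory.finiteProducts
  exact ⟨0, isZero_zero _, (isFinitelyPresentable.{w} C).prop_of_isLimit_fan
    (Fan.IsLimit.mk (f := fun x : Empty => x.elim) (Fan.mk (0 : C) (fun x => x.elim)) (fun _ => 0)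
      (fun _ x => x.elim) (fun _ _ _ => (isZero_zero C).eq_of_tgt _ _))
    (fun x => x.elim)⟩

lemma IsLocallyCoherentGrothendieck.isTriangulated_boundedFP
    (hG : IsLocallyCoherentGrothendieck.{v} G) : (boundedFP G).IsTriangulated := by
  have := hG.isAbelianExactSubcategory.kernels
  have := hG.isAbelianExactSubcategory.cokernels
  have := hG.isClosedUnderExtensions
  have := hG.containsZero
  exact inferInstanceAs (TStructure.t.bounded ⊓
    homologyProperty (isFinitelyPresentable.{v} G)).IsTriangulated

lemma IsLocallyCoherentGrothendieck.essentiallySmall_boundedFP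
    (hG : IsLocallyCoherentGrothendieck.{v} G) :
    ObjectProperty.EssentiallySmall.{v} (boundedFP G) := by
  have := hG.isGrothendieckAbelian
  have := hG.essentiallySmall_isFinitelyPresentable
  have := hG.containsZero
  exact essentiallySmall_bounded_homologyProperty (isFinitelyPresentable.{v} G)

section

variable {J : Type*} [Category* J] [IsFiltered J] {F : J ⥤ DerivedCategory G} {c : Cocone F}

instance : (ShiftedHomColimBijective c).IsTriangulated where
  exists_zero := ⟨0, isZero_zero _, fun n => by
    have h : IsZero ((0 : DerivedCategory G)⟦n⟧) := (shiftFunctor _ n).map_isZero (isZero_zero _)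
    refine ⟨fun j g hg => ⟨j, 𝟙 j, h.eq_of_src _ _⟩, fun g => ?_⟩
    obtain ⟨j⟩ := IsFiltered.nonempty (C := J)
    exact ⟨j, 0, h.eq_of_src _ _⟩⟩

/-- Descending induction on the shift: for `n ≥ 1 - m` the object `A⟦n⟧` lies in degree below `m`,
so both sides vanish. Otherwise use 0 → K → P → A → 0 with P a finite coproduct of objects of `S`
and K finitely presented by coherence. -/
lemma shiftedHomColimBijective_singleFunctor_obj
    (hG : IsLocallyCoherentGrothendieck.{v} G) {S : ObjectProperty G}
    (hS : S ≤ isFinitelyPresentable.{v} G) (hS' : IsGeneratingClass.{v} S)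
    (hSc : ∀ A, S A → ShiftedHomColimBijective c ((singleFunctor G 0).obj A)) (m : ℤ)
    (hF : ∀ j, (F.obj j).IsGE m) (hc : c.pt.IsGE m) (A : G) (hA : isFinitelyPresentable.{v} G A) :
    ShiftedHomColimBijective c ((singleFunctor G 0).obj A) := by
  have := hG.isAbelianExactSubcategory.kernels
  have := hG.isAbelianExactSubcategory.finiteCoproducts
  have : (ShiftedHomColimBijective c).IsClosedUnderFiniteCoproducts :=
    isClosedUnderFiniteCoproducts_of_isClosedUnderFiniteProducts _
  suffices ∀ (k : ℕ) (n : ℤ), 1 - m ≤ n + k → ∀ A, isFinitelyPresentable.{v} G A →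
      HomColimInjective c (((singleFunctor G 0).obj A)⟦n⟧) ∧
      HomColimSurjective c (((singleFunctor G 0).obj A)⟦n⟧) from
    fun n => this (1 - m - n).toNat n (by lia) A hA
  clear hA A
  intro k
  induction k with
  | zero =>
    intro n hn A hA
    have : (((singleFunctor G 0).obj A)⟦n⟧).IsLE (-n) := TStructure.t.isLE_shift _ 0 n (-n)
    refine ⟨fun j g hg => ⟨j, 𝟙 j, ?_⟩, fun g => ?_⟩
    · rw [TStructure.t.zero g (-n) m, zero_comp]
    · obtain ⟨j⟩ := IsFiltered.nonempty (C := J)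
      exact ⟨j, 0, by rw [TStructure.t.zero g (-n) m, zero_comp]⟩
  | succ k hk =>
    intro n hn A hA
    have hn' : 1 - m ≤ n + 1 + k := by lia
    have h₁ (A) (hA : isFinitelyPresentable.{v} G A) :
        HomColimInjective c (((singleFunctor G 0).obj A)⟦n⟧⟦(1 : ℤ)⟧) ∧
        HomColimSurjective c (((singleFunctor G 0).obj A)⟦n⟧⟦(1 : ℤ)⟧) :=
      ⟨(HomColimInjective c).prop_of_iso ((shiftFunctorAdd' _ n 1 _ rfl).app _)
        (hk (n + 1) hn' A hA).1, (HomColimSurjective c).prop_of_iso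
        ((shiftFunctorAdd' _ n 1 _ rfl).app _) (hk (n + 1) hn' A hA).2⟩
    have aux (A) (hA : isFinitelyPresentable.{v} G A) :
        ∃ (K P : G), isFinitelyPresentable.{v} G K ∧
          ShiftedHomColimBijective c ((singleFunctor G 0).obj P) ∧
          isFinitelyPresentable.{v} G P ∧
          ∃ (f : ((singleFunctor G 0).obj K)⟦n⟧ ⟶ ((singleFunctor G 0).obj P)⟦n⟧)
            (g : ((singleFunctor G 0).obj P)⟦n⟧ ⟶ ((singleFunctor G 0).obj A)⟦n⟧) (h : _),
            Triangle.mk f g h ∈ distTriang _ := by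
      have : IsFinitelyPresentable.{v} A := hA
      obtain ⟨J, _, X, d, hd, p, hX, _⟩ := hG.exists_epi_of_isGeneratingClass hS'
        (filteredHomColimInjective_of_isFinitelyPresentable A)
      have hP : isFinitelyPresentable.{v} G d.pt :=
        prop_of_isColimit_cofan _ hd (fun j => hS _ (hX j))
      have hT : (ShortComplex.mk _ _ (kernel.condition p)).ShortExact :=
        { exact := ShortComplex.exact_kernel p }
      refine ⟨kernel p, d.pt, prop_kernel _ _ hP hA, ?_, hP, _, _, _,
        Triangle.shift_distinguished _ hT.singleTriangle_distinguished n⟩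
      exact prop_of_isColimit_cofan (ShiftedHomColimBijective c)
        (isColimitCofanMkObjOfIsColimit (singleFunctor G 0) X d.inj
          (IsColimit.ofIsoColimit hd (Cofan.ext (Iso.refl _) (by simp)))) (fun j => hSc _ (hX j))
    -- Injectivity at shift `n` needs only shift `n + 1` for `K` and `P`, besides `P` itself at `n`.
    -- It must be proved for all finitely presented objects first, since surjectivity for `A` uses
    -- injectivity for `K` at the same shift.
    have inj (A) (hA : isFinitelyPresentable.{v} G A) :
        HomColimInjective c (((singleFunctor G 0).obj A)⟦n⟧) := by
      obtain ⟨K, P, hK, hP, hP', f, g, h, hT⟩ := aux A hA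
      exact .of_distTriang hT (h₁ P hP').2 (h₁ K hK).1 (hP n).1
    refine ⟨inj A hA, ?_⟩
    obtain ⟨K, P, hK, hP, -, f, g, h, hT⟩ := aux A hA
    exact .of_distTriang hT (h₁ K hK).2 (hP n).2 (inj K hK)

lemma shiftedHomColimBijective_of_boundedFP
    (hG : IsLocallyCoherentGrothendieck.{v} G) {S : ObjectProperty G}
    (hS : S ≤ isFinitelyPresentable.{v} G) (hS' : IsGeneratingClass.{v} S)
    (hSc : ∀ A, S A → ShiftedHomColimBijective c ((singleFunctor G 0).obj A)) (m : ℤ)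
    (hF : ∀ j, (F.obj j).IsGE m) (hc : c.pt.IsGE m) :
    boundedFP G ≤ ShiftedHomColimBijective c := fun X hX => by
  have := hG.containsZero
  refine prop_of_bounded (isFinitelyPresentable.{v} G) _ (fun A n hA => ?_) hX.1 hX.2
  exact prop_of_iso _ (((singleFunctors G).shiftIso (-n) n 0 (by simp)).app A)
    ((ShiftedHomColimBijective c).le_shift (-n) _
      (shiftedHomColimBijective_singleFunctor_obj hG hS hS' hSc m hF hc A hA))

lemma isZero_of_forall_hom_eq_zero {C : Type*} [Category* C] [HasZeroMorphisms C]
    {S : ObjectProperty C} (hS : IsGeneratingClass.{w} S) (X : C)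
    (hX : ∀ A, S A → ∀ (x : A ⟶ X), x = 0) : IsZero X := by
  obtain ⟨J, F, c, hc, p, hF, _⟩ := hS X
  obtain rfl : p = 0 := Cofan.IsColimit.hom_ext hc _ _ (fun j => by
    rw [hX _ (hF j) (c.inj j ≫ p), comp_zero])
  rw [IsZero.iff_id_eq_zero, ← cancel_epi (0 : c.pt ⟶ X)]
  simp

/-- Homologically bounded below complexes are detected by the morphisms from shifts of
generators of the abelian category. -/
lemma isZero_of_forall_shift_hom_eq_zero {S : ObjectProperty G} (hS : IsGeneratingClass.{v} S)
    (X : DerivedCategory G) (m : ℤ) [X.IsGE m]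
    (hX : ∀ A, S A → ∀ (n : ℤ) (x : ((singleFunctor G 0).obj A)⟦n⟧ ⟶ X), x = 0) : IsZero X := by
  -- The lowest possible homology object is removed one degree at a time. A map from a generator to
  -- that stalk `X'` becomes zero in `X` by hypothesis, hence lifts to `X''⟦-1⟧`, which starts two
  -- degrees higher; so the map is zero.
  have hGE (k : ℕ) : X.IsGE (m + k) := by
    induction k with
    | zero => simpa
    | succ k hk =>
      obtain ⟨X', X'', hX', hX'', f, g, h, hT⟩ :=
        TStructure.t.exists_triangle X (m + k) (m + (k + 1 : ℕ)) (by lia)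
      replace hX' : X'.IsLE (m + k) := ⟨hX'⟩
      replace hX'' : X''.IsGE (m + (k + 1 : ℕ)) := ⟨hX''⟩
      have hX₂ : (X''⟦(-1 : ℤ)⟧).IsGE (m + k + 2) := TStructure.t.isGE_shift _ (m + (k + 1 : ℕ)) (-1) _
      have : X'.IsGE (m + k) := TStructure.t.isGE₂ _ (inv_rot_of_distTriang _ hT) (m + k)
        (TStructure.t.isGE_of_ge (X''⟦(-1 : ℤ)⟧) _ (m + k + 2)) hk
      obtain ⟨A, ⟨e⟩⟩ := exists_iso_singleFunctor_obj_of_isGE_of_isLE X' (m + k)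
      have hA : IsZero A := by
        refine isZero_of_forall_hom_eq_zero hS A (fun B hB x => ?_)
        let i := ((singleFunctors G).shiftIso (-(m + k)) (m + k) 0 (by lia)).app B
        have h₀ : ((singleFunctor G (m + k)).map x ≫ e.inv) ≫ f = 0 := by
          rw [← cancel_epi i.hom, comp_zero]
          exact hX B hB _ _
        obtain ⟨y, hy⟩ := distTriang_lift₂ (inv_rot_of_distTriang _ hT :) _ h₀
        rw [TStructure.t.zero_of_isLE_of_isGE y (m + k) (m + k + 2) (by lia) inferInstance hX₂,
          zero_comp] at hy
        apply (singleFunctor G (m + k)).map_injective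
        rw [← cancel_mono e.inv, hy, Functor.map_zero, zero_comp]
        rfl
      have hX₀ : IsZero X' := ((singleFunctor G (m + k)).map_isZero hA).of_iso e
      exact TStructure.t.isGE₂ _ hT _ (TStructure.t.isGE_of_isZero hX₀ _) hX''
  have : X.IsLE (m - 1) := (isLE_iff _ _).2 (fun i hi =>
    have := hGE (i + 1 - m).toNat
    isZero_of_isGE X (m + (i + 1 - m).toNat) i (by lia))
  exact TStructure.t.isZero X (m - 1) m

end

end BoundedFP

/-! ### Coproducts of complexes tested against bounded below targets -/

lemma HomologicalComplex.nonempty_homotopy_of_coproduct {C : Type*} [Category* C] [Preadditive C]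
    {α : Type*} {s : ComplexShape α} {J : Type*} {K : J → HomologicalComplex C s} [HasCoproduct K]
    [∀ i, PreservesColimit (Discrete.functor K) (HomologicalComplex.eval C s i)]
    {L : HomologicalComplex C s} (f g : ∐ K ⟶ L)
    (h : ∀ j, Homotopy (Sigma.ι K j ≫ f) (Sigma.ι K j ≫ g)) : Nonempty (Homotopy f g) := by
  let hc (i : α) := isColimitCofanMkObjOfIsColimit (HomologicalComplex.eval C s i) K (Sigma.ι K)
    (coproductIsCoproduct K)
  -- Coproducts of complexes are computed degreewise, so the components of the given homotopies
  -- glue.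
  let φ (a b : α) : (∐ K).X a ⟶ L.X b := Cofan.IsColimit.desc (hc a) (fun j => (h j).hom a b)
  have hφ (j : J) (a b : α) : (Sigma.ι K j).f a ≫ φ a b = (h j).hom a b :=
    Cofan.IsColimit.fac (hc a) (fun j => (h j).hom a b) j
  have ext {a : α} {Z : C} {x y : (∐ K).X a ⟶ Z}
      (hxy : ∀ j, (Sigma.ι K j).f a ≫ x = (Sigma.ι K j).f a ≫ y) : x = y :=
    Cofan.IsColimit.hom_ext (hc a) _ _ hxy
  exact ⟨{
    hom := φ
    zero a b hab := ext (fun j => by rw [hφ, (h j).zero a b hab, comp_zero])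
    comm a := ext (fun j => by
      have := (h j).comm a
      rw [show (h j).hom = fun a b => (Sigma.ι K j).f a ≫ φ a b by ext; rw [hφ],
        dNext_comp_left, prevD_comp_left] at this
      simpa using this) }⟩

namespace DerivedCategory

variable {G : Type u} [Category.{v} G] [Abelian G] [HasDerivedCategory.{w} G]

lemma Q_map_surjective_of_isKInjective {K L : CochainComplex G ℤ} [L.IsKInjective]
    (φ : Q.obj K ⟶ Q.obj L) : ∃ f : K ⟶ L, Q.map f = φ := by
  let e := quotientCompQhIso G
  obtain ⟨f, hf⟩ := (CochainComplex.IsKInjective.Qh_map_bijective _ L).2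
    (e.hom.app K ≫ φ ≫ e.inv.app L)
  obtain ⟨f, rfl⟩ := (HomotopyCategory.quotient G (.up ℤ)).map_surjective f
  refine ⟨f, ?_⟩
  have := e.hom.naturality f
  rw [← cancel_epi (e.hom.app K), ← this]
  simp [hf, e]

lemma nonempty_homotopy_of_Q_map_eq {K L : CochainComplex G ℤ} [L.IsKInjective]
    {f g : K ⟶ L} (h : Q.map f = Q.map g) : Nonempty (Homotopy f g) := by
  let e := quotientCompQhIso G
  refine ⟨HomotopyCategory.homotopyOfEq _ _
    ((CochainComplex.IsKInjective.Qh_map_bijective _ L).1 ?_)⟩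
  have hf := e.hom.naturality f
  have hg := e.hom.naturality g
  rw [h, ← hg] at hf
  exact (cancel_mono _).1 hf

lemma exists_iso_Q_obj_isKInjective [IsGrothendieckAbelian.{v} G] (Z : DerivedCategory G) (n : ℤ)
    [Z.IsGE n] :
    ∃ (L : CochainComplex G ℤ) (_ : L.IsKInjective), Nonempty (Z ≅ Q.obj L) := by
  obtain ⟨K, _, ⟨e⟩⟩ := Z.exists_iso_Q_obj_of_isGE n
  obtain ⟨L, i, _, _, _⟩ := CochainComplex.Plus.modelCategoryQuillen.exists_quasiIso_injective K n
  exact ⟨L, CochainComplex.isKInjective_of_injective L n, ⟨e ≪≫ asIso (Q.map i)⟩⟩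

/-- Small coproducts in the derived category, with respect to bounded below targets. -/
lemma exists_coproduct_of_isGE [IsGrothendieckAbelian.{v} G] {J : Type v}
    (X : J → DerivedCategory G) :
    ∃ (Y : DerivedCategory G) (i : ∀ j, X j ⟶ Y), ∀ (Z : DerivedCategory G) (n : ℤ), Z.IsGE n →
      (∀ f : ∀ j, X j ⟶ Z, ∃ g : Y ⟶ Z, ∀ j, i j ≫ g = f j) ∧
      (∀ g g' : Y ⟶ Z, (∀ j, i j ≫ g = i j ≫ g') → g = g') := by
  let K (j : J) := Q.objPreimage (X j)
  let e (j : J) : Q.obj (K j) ≅ X j := Q.objObjPreimageIso (X j)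
  refine ⟨Q.obj (∐ K), fun j => (e j).inv ≫ Q.map (Sigma.ι K j), fun Z n hZ => ?_⟩
  -- Morphisms into a K-injective complex are homotopy classes of chain maps, for which the
  -- coproduct of complexes has the universal property.
  obtain ⟨L, _, ⟨e'⟩⟩ := exists_iso_Q_obj_isKInjective Z n
  refine ⟨fun f => ?_, fun g g' h => ?_⟩
  · choose φ hφ using fun j => Q_map_surjective_of_isKInjective ((e j).hom ≫ f j ≫ e'.hom)
    exact ⟨Q.map (Sigma.desc φ) ≫ e'.inv, fun j => by
      rw [Category.assoc, ← Q.map_comp_assoc, Sigma.ι_desc, hφ]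
      simp⟩
  · obtain ⟨φ, hφ⟩ := Q_map_surjective_of_isKInjective (g ≫ e'.hom)
    obtain ⟨φ', hφ'⟩ := Q_map_surjective_of_isKInjective (g' ≫ e'.hom)
    obtain ⟨H⟩ := HomologicalComplex.nonempty_homotopy_of_coproduct φ φ' (fun j =>
      (nonempty_homotopy_of_Q_map_eq (by
        have := h j
        rw [Category.assoc, Category.assoc, cancel_epi] at this
        rw [Q.map_comp, Q.map_comp, hφ, hφ', reassoc_of% this])).some)
    rw [← cancel_mono e'.hom, ← hφ, ← hφ', Q_map_eq_of_homotopy _ H]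

end DerivedCategory

/-! ### Kernels, cokernels and coproducts in the heart -/

section Pretriangulated

variable {C : Type*} [Category* C] [Preadditive C] [HasZeroObject C] [HasShift C ℤ]
  [∀ n : ℤ, (shiftFunctor C n).Additive] [Pretriangulated C]
  {X Y Z : C} {f : X ⟶ Y} {g : Y ⟶ Z} {h : Z ⟶ X⟦(1 : ℤ)⟧}

lemma distTriang_shift (hT : Triangle.mk f g h ∈ distTriang C) (n : ℤ) :
    ∃ (f' : X⟦n⟧ ⟶ Y⟦n⟧) (g' : Y⟦n⟧ ⟶ Z⟦n⟧) (h' : Z⟦n⟧ ⟶ X⟦n⟧⟦(1 : ℤ)⟧),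
      Triangle.mk f' g' h' ∈ distTriang C :=
  ⟨_, _, _, Triangle.shift_distinguished _ hT n⟩

lemma distTriang_of_iso₂ (hT : Triangle.mk f g h ∈ distTriang C) {Y' : C} (e : Y' ≅ Y) :
    Triangle.mk (f ≫ e.inv) (e.hom ≫ g) h ∈ distTriang C :=
  distTriang_of_iso hT (Iso.refl _) e (Iso.refl _) (by simp) (by simp) (by simp)

end Pretriangulated

namespace CategoryTheory.Triangulated.TStructure

variable {C : Type*} [Category* C] [Preadditive C] [HasZeroObject C] [HasShift C ℤ]
  [∀ n : ℤ, (shiftFunctor C n).Additive] [Pretriangulated C] (t : TStructure C)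

instance (X : t.heart.FullSubcategory) : t.IsLE X.obj 0 := ⟨X.property.1⟩

instance (X : t.heart.FullSubcategory) : t.IsGE X.obj 0 := ⟨X.property.2⟩

instance (X : t.heart.FullSubcategory) : t.IsLE (t.heart.ι.obj X) 0 := ⟨X.property.1⟩

instance (X : t.heart.FullSubcategory) : t.IsGE (t.heart.ι.obj X) 0 := ⟨X.property.2⟩

instance : t.heart.IsClosedUnderIsomorphisms :=
  inferInstanceAs (t.le 0 ⊓ t.ge 0).IsClosedUnderIsomorphisms

open ZeroObject in
instance : t.heart.ContainsZero where
  exists_zero := ⟨0, isZero_zero C, (t.isLE_of_isZero (isZero_zero C) 0).le,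
    (t.isGE_of_isZero (isZero_zero C) 0).ge⟩

instance : t.heart.IsTriangulatedClosed₂ := .mk' (fun T hT h₁ h₃ =>
  ⟨(t.isLE₂ T hT 0 ⟨h₁.1⟩ ⟨h₃.1⟩).le, (t.isGE₂ T hT 0 ⟨h₁.2⟩ ⟨h₃.2⟩).ge⟩)

instance : t.heart.IsClosedUnderBinaryProducts where
  limitsOfShape_le := by
    rintro X ⟨p⟩
    refine t.heart.prop_of_iso ?_ (t.heart.ext_of_isTriangulatedClosed₂ _
      (binaryProductTriangle_distinguished _ _)
      (p.prop_diag_obj (.mk .left)) (p.prop_diag_obj (.mk .right)))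
    exact IsLimit.conePointUniqueUpToIso (prodIsProd _ _)
      ((IsLimit.postcomposeHomEquiv (diagramIsoPair p.diag) _).2 p.isLimit)

instance : t.heart.IsClosedUnderFiniteProducts := .mk'

lemma heart_hom_eq_zero ⦃X Y : t.heart.FullSubcategory⦄ ⦃n : ℤ⦄
    (f : t.heart.ι.obj X ⟶ (t.heart.ι.obj Y)⟦n⟧) (hn : n < 0) : f = 0 :=
  t.zero_of_isLE_of_isGE f 0 (-n) (by lia) inferInstance (t.isGE_shift _ 0 n (-n))

/-- The truncation triangle of the cone of a morphism in the heart gives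
the kernel and the cokernel of this morphism. -/
lemma exists_heart_distTriang_of_cone {X₁ X₂ : t.heart.FullSubcategory} {f : X₁ ⟶ X₂}
    {X₃ : C} {f₂ : t.heart.ι.obj X₂ ⟶ X₃} {f₃ : X₃ ⟶ (t.heart.ι.obj X₁)⟦(1 : ℤ)⟧}
    (hT : Triangle.mk (t.heart.ι.map f) f₂ f₃ ∈ distTriang C) {U V : C} {a : U ⟶ X₃⟦(-1 : ℤ)⟧}
    {b : X₃⟦(-1 : ℤ)⟧ ⟶ V} {c : V ⟶ U⟦(1 : ℤ)⟧} (hU : Triangle.mk a b c ∈ distTriang C)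
    (hU₀ : t.le 0 U) (hV₁ : t.ge 1 V) :
    ∃ (K Q : t.heart.FullSubcategory) (α : (t.heart.ι.obj K)⟦(1 : ℤ)⟧ ⟶ X₃)
      (β : X₃ ⟶ t.heart.ι.obj Q) (γ : t.heart.ι.obj Q ⟶ (t.heart.ι.obj K)⟦(1 : ℤ)⟧⟦(1 : ℤ)⟧),
      Triangle.mk α β γ ∈ distTriang C ∧ K.obj = U ∧ Q.obj = V⟦(1 : ℤ)⟧ := by
  -- The cone has amplitude [-1, 0], so its shift by -1 has amplitude [0, 1]. Truncating that shift
  -- between 0 and 1 is the form provided by `TStructureRestrictsTo`; shifting back gives `U⟦1⟧` and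
  -- `V⟦1⟧`.
  have hX₁ : t.IsLE ((t.heart.ι.obj X₁)⟦(1 : ℤ)⟧) (-1) := t.isLE_shift _ 0 1 (-1)
  have hX₁' : t.IsGE ((t.heart.ι.obj X₁)⟦(1 : ℤ)⟧) (-1) := t.isGE_shift _ 0 1 (-1)
  have hX₃ : t.IsLE X₃ 0 := t.isLE₂ _ (rot_of_distTriang _ hT) 0
    (inferInstanceAs (t.IsLE (t.heart.ι.obj X₂) 0)) (t.isLE_of_le ((t.heart.ι.obj X₁)⟦(1 : ℤ)⟧) (-1) 0)
  have hX₃' : t.IsGE X₃ (-1) := t.isGE₂ _ (rot_of_distTriang _ hT) (-1)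
    (t.isGE_of_ge (t.heart.ι.obj X₂) (-1) 0) hX₁'
  have h₁ : t.IsLE (X₃⟦(-1 : ℤ)⟧) 1 := t.isLE_shift _ 0 (-1) 1
  have h₂ : t.IsGE (X₃⟦(-1 : ℤ)⟧) 0 := t.isGE_shift _ (-1) (-1) 0
  have hU' : t.IsLE U 0 := ⟨hU₀⟩
  have hV' : t.IsGE V 1 := ⟨hV₁⟩
  have hU₁ : t.IsLE (U⟦(1 : ℤ)⟧) (-1) := t.isLE_shift _ 0 1 (-1)
  have hV₂ : t.IsGE (V⟦(-1 : ℤ)⟧) 2 := t.isGE_shift _ 1 (-1) 2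
  have hU₀' : t.IsGE U 0 := t.isGE₂ _ (inv_rot_of_distTriang _ hU) 0
    (t.isGE_of_ge (V⟦(-1 : ℤ)⟧) 0 2) h₂
  have hV₁' : t.IsLE V 1 := t.isLE₂ _ (rot_of_distTriang _ hU) 1 h₁
    (t.isLE_of_le (U⟦(1 : ℤ)⟧) (-1) 1)
  have hVl : t.IsLE (V⟦(1 : ℤ)⟧) 0 := t.isLE_shift _ 1 1 0
  have hVg : t.IsGE (V⟦(1 : ℤ)⟧) 0 := t.isGE_shift _ 1 1 0
  obtain ⟨f', g', h', hT'⟩ := distTriang_shift hU 1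
  exact ⟨⟨U, hU₀, hU₀'.ge⟩, ⟨V⟦(1 : ℤ)⟧, hVl.le, hVg.ge⟩, _, _, _,
    distTriang_of_iso₂ hT' ((shiftEquiv' C (-1) 1 (by simp)).unitIso.app X₃), rfl, rfl⟩

lemma admissibleMorphism_heart : AbelianSubcategory.admissibleMorphism t.heart.ι = ⊤ := by
  rw [eq_top_iff]
  intro X₁ X₂ f _ X₃ f₂ f₃ hT
  obtain ⟨U, V, hU, hV, a, b, c, hU'⟩ := t.exists_triangle (X₃⟦(-1 : ℤ)⟧) 0 1 (by simp)
  obtain ⟨K, Q, α, β, γ, h, -⟩ := t.exists_heart_distTriang_of_cone hT hU' hU hV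
  exact ⟨K, Q, α, β, γ, h⟩

noncomputable instance abelianHeart [IsTriangulated C] : Abelian t.heart.FullSubcategory :=
  AbelianSubcategory.abelian t.heart.ι t.heart_hom_eq_zero t.admissibleMorphism_heart

/-- The kernel is a truncation of the shifted cone, and the truncation triangle can be taken inside
`P`. -/
lemma isClosedUnderKernels_inverseImage_heart {P : ObjectProperty C} [P.IsTriangulated]
    [P.IsClosedUnderIsomorphisms] (hP : TStructureRestrictsTo t P) :
    (P.inverseImage t.heart.ι).IsClosedUnderKernels where
  kernels_le := by
    rintro _ ⟨f, k, hk, hX, hY⟩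
    obtain ⟨X₃, f₂, f₃, hT⟩ := distinguished_cocone_triangle (t.heart.ι.map f)
    obtain ⟨U, V, a, b, c, hU, hU₀, hV₁, hU', hV'⟩ :=
      hP (X₃⟦(-1 : ℤ)⟧) (P.le_shift (-1) _ (P.ext_of_isTriangulatedClosed₃ _ hT hX hY))
    obtain ⟨K, Q, α, β, γ, h, hK, hQ⟩ := t.exists_heart_distTriang_of_cone hT hU hU₀ hV₁
    refine (P.inverseImage t.heart.ι).prop_of_iso (IsLimit.conePointUniqueUpToIso
      (AbelianSubcategory.isLimitKernelFork t.heart_hom_eq_zero hT h) hk) ?_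
    change P K.obj
    rwa [hK]

lemma isClosedUnderCokernels_inverseImage_heart {P : ObjectProperty C} [P.IsTriangulated]
    [P.IsClosedUnderIsomorphisms] (hP : TStructureRestrictsTo t P) :
    (P.inverseImage t.heart.ι).IsClosedUnderCokernels where
  cokernels_le := by
    rintro _ ⟨f, k, hk, hX, hY⟩
    obtain ⟨X₃, f₂, f₃, hT⟩ := distinguished_cocone_triangle (t.heart.ι.map f)
    obtain ⟨U, V, a, b, c, hU, hU₀, hV₁, hU', hV'⟩ :=
      hP (X₃⟦(-1 : ℤ)⟧) (P.le_shift (-1) _ (P.ext_of_isTriangulatedClosed₃ _ hT hX hY))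
    obtain ⟨K, Q, α, β, γ, h, hK, hQ⟩ := t.exists_heart_distTriang_of_cone hT hU hU₀ hV₁
    refine (P.inverseImage t.heart.ι).prop_of_iso (IsColimit.coconePointUniqueUpToIso
      (AbelianSubcategory.isColimitCokernelCofork t.heart_hom_eq_zero hT h) hk) ?_
    change P Q.obj
    rw [hQ]
    exact P.le_shift 1 _ hV'

/-- `Y` is a coproduct as seen by objects of `t.ge 0`. Orthogonality puts it in the aisle, so its
truncation to `t.ge 0` lies in the heart and keeps the universal property there. -/
lemma hasCoproduct_heart {J : Type*} (X : J → t.heart.FullSubcategory) {Y : C}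
    (i : ∀ j, (X j).obj ⟶ Y)
    (hY : ∀ (Z : C), t.ge 0 Z → (∀ f : ∀ j, (X j).obj ⟶ Z, ∃ g : Y ⟶ Z, ∀ j, i j ≫ g = f j) ∧
      (∀ g g' : Y ⟶ Z, (∀ j, i j ≫ g = i j ≫ g') → g = g')) : HasCoproduct X := by
  have hY₀ : t.IsLE Y 0 := (t.isLE_iff_orthogonal 0 1 (by simp) Y).2 (fun Z f _ =>
    (hY Z (t.ge_antitone zero_le_one _ (t.ge_of_isGE Z 1))).2 _ _ (fun j => by
      rw [t.zero (i j ≫ f) 0 1, comp_zero]))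
  have : t.IsLE ((t.truncLT 0).obj Y) (-1) := t.isLE_truncLT_obj Y 0 (-1)
  have : t.IsLE (((t.truncLT 0).obj Y)⟦(1 : ℤ)⟧) (-2) := t.isLE_shift _ (-1) 1 (-2)
  have hY₀' : t.IsLE ((t.truncGE 0).obj Y) 0 :=
    t.isLE₂ _ (rot_of_distTriang _ (t.triangleLTGE_distinguished 0 Y)) 0 hY₀
      (t.isLE_of_le (((t.truncLT 0).obj Y)⟦(1 : ℤ)⟧) (-2) 0)
  let Y' : t.heart.FullSubcategory := ⟨(t.truncGE 0).obj Y, hY₀'.le, (t.ge_of_isGE _ 0)⟩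
  let c : Cofan X := Cofan.mk Y' (fun j => ObjectProperty.homMk (i j ≫ (t.truncGEπ 0).app Y))
  have hc (Z : t.heart.FullSubcategory) (f : ∀ j, X j ⟶ Z) : ∃ g : Y' ⟶ Z,
      ∀ j, c.inj j ≫ g = f j := by
    obtain ⟨g, hg⟩ := (hY Z.obj Z.property.2).1 (fun j => (f j).hom)
    refine ⟨ObjectProperty.homMk (t.descTruncGE g 0), fun j => ?_⟩
    ext
    simp [c, hg]
  refine ⟨⟨⟨c, Cofan.IsColimit.mk c (fun s => (hc s.pt s.inj).choose)
    (fun s => (hc s.pt s.inj).choose_spec) (fun s m hm => ?_)⟩⟩⟩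
  ext
  apply t.from_truncGE_obj_ext
  refine (hY s.pt.obj s.pt.property.2).2 _ _ (fun j => ?_)
  have := (hm j).trans ((hc s.pt s.inj).choose_spec j).symm
  simpa [c] using congr_arg (·.hom) this

end CategoryTheory.Triangulated.TStructure

/-! ### Exactness of filtered colimits in the heart -/

namespace CategoryTheory.Triangulated.TStructure

variable {C : Type*} [Category* C] [Preadditive C] [HasZeroObject C] [HasShift C ℤ]
  [∀ n : ℤ, (shiftFunctor C n).Additive] [Pretriangulated C] (t : TStructure C)
  [IsTriangulated C]

lemma exists_heart_distTriang_of_shortExact {X Y Z : t.heart.FullSubcategory} (f : X ⟶ Y)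
    (g : Y ⟶ Z) (w : f ≫ g = 0) (hS : (ShortComplex.mk f g w).ShortExact) :
    ∃ (δ : t.heart.ι.obj Z ⟶ (t.heart.ι.obj X)⟦(1 : ℤ)⟧),
      Triangle.mk (t.heart.ι.map f) (t.heart.ι.map g) δ ∈ distTriang C := by
  have : Mono f := hS.mono_f
  have : Epi g := hS.epi_g
  obtain ⟨X', i, δ, hT⟩ := AbelianSubcategory.exists_distinguished_triangle_of_epi
    t.heart_hom_eq_zero t.admissibleMorphism_heart g
  have hi := AbelianSubcategory.isLimitKernelForkOfDistTriang t.heart_hom_eq_zero i g δ hT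
  let e : X ≅ X' := IsLimit.conePointUniqueUpToIso hS.fIsKernel hi
  have he : e.hom ≫ i = f := IsLimit.conePointUniqueUpToIso_hom_comp hS.fIsKernel hi .zero
  exact ⟨δ ≫ (t.heart.ι.map e.inv)⟦(1 : ℤ)⟧', distTriang_of_iso hT (t.heart.ι.mapIso e)
    (Iso.refl _) (Iso.refl _) (by
      rw [Functor.mapIso_hom, ← Functor.map_comp, he, Iso.refl_hom, Category.comp_id]) (by simp)
    (by simp [← Functor.map_comp])⟩

lemma mono_colim_map_heart {J : Type*} [Category* J] [IsFiltered J]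
    [HasColimitsOfShape J t.heart.FullSubcategory] (S : ObjectProperty C)
    (hS : ∀ s, S s → ∀ F : J ⥤ t.heart.FullSubcategory,
      ShiftedHomColimBijective (t.heart.ι.mapCocone (colimit.cocone F)) s)
    (hS' : ∀ K : t.heart.FullSubcategory,
      (∀ s, S s → ∀ x : s ⟶ (t.heart.ι.obj K)⟦(1 : ℤ)⟧, x = 0) → IsZero K)
    {M N : J ⥤ t.heart.FullSubcategory} (α : M ⟶ N) [Mono α] : Mono (colim.map α) := by
  let P := cokernel α
  let β : N ⟶ P := cokernel.π α
  have hαβ : (ShortComplex.mk α β (cokernel.condition α)).ShortExact :=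
    { exact := ShortComplex.exact_cokernel α }
  choose δ hδ using fun j => t.exists_heart_distTriang_of_shortExact (α.app j) (β.app j) _
    (hαβ.map_of_exact ((evaluation _ _).obj j))
  let f : (colimit.cocone M).pt ⟶ (colimit.cocone N).pt := colim.map α
  let g : (colimit.cocone N).pt ⟶ (colimit.cocone P).pt := colim.map β
  have hfg : f ≫ g = 0 := by
    rw [← colim.map_comp, cokernel.condition, colim.map_zero]
  -- `colim` preserves cokernels, which identifies the cokernel `Q` read off from the cone with the
  -- colimit of `P`, as the chase requires.
  have hg : IsColimit (CokernelCofork.ofπ g hfg) :=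
    CokernelCofork.mapIsColimit _ (cokernelIsCokernel α) colim
  obtain ⟨Z, f₂, f₃, hZ⟩ := distinguished_cocone_triangle (t.heart.ι.map f)
  have hf : AbelianSubcategory.admissibleMorphism t.heart.ι f := by
    simp [t.admissibleMorphism_heart]
  obtain ⟨K, Q, a, b, γ, hK⟩ := hf f₂ f₃ hZ
  let e : Q ≅ (colimit.cocone P).pt := IsColimit.coconePointUniqueUpToIso
    (AbelianSubcategory.isColimitCokernelCofork t.heart_hom_eq_zero hZ hK) hg
  have he : AbelianSubcategory.πQ f₂ b ≫ e.hom = g :=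
    IsColimit.comp_coconePointUniqueUpToIso_hom
      (AbelianSubcategory.isColimitCokernelCofork t.heart_hom_eq_zero hZ hK) hg .one
  have he' : f₂ ≫ b ≫ t.heart.ι.map e.hom = t.heart.ι.map g := by
    rw [← he, Functor.map_comp, AbelianSubcategory.ι_map_πQ, Category.assoc]
  have hK₀ : IsZero K := hS' K (fun s hs x =>
    eq_zero_of_filtered_colimit_of_distTriang t.heart.ι α β δ hδ
      (colimit.cocone M) (colimit.cocone N) (colimit.cocone P) f g (fun j => colimit.ι_map _ _)
      (fun j => colimit.ι_map _ _) hZ hK e.hom he' (hS s hs M) (hS s hs N) (hS s hs P) x)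
  refine Preadditive.mono_of_cancel_zero f (fun {A} y hy => ?_)
  obtain ⟨l, rfl⟩ := AbelianSubcategory.exists_lift_ιK t.heart_hom_eq_zero hZ hK y hy
  rw [hK₀.eq_of_tgt l 0, zero_comp]

lemma hasExactColimitsOfShape_heart (J : Type*) [Category* J] [IsFiltered J]
    [HasColimitsOfShape J t.heart.FullSubcategory] (S : ObjectProperty C)
    (hS : ∀ s, S s → ∀ F : J ⥤ t.heart.FullSubcategory,
      ShiftedHomColimBijective (t.heart.ι.mapCocone (colimit.cocone F)) s)
    (hS' : ∀ K : t.heart.FullSubcategory,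
      (∀ s, S s → ∀ x : s ⟶ (t.heart.ι.obj K)⟦(1 : ℤ)⟧, x = 0) → IsZero K) :
    HasExactColimitsOfShape J t.heart.FullSubcategory :=
  have : (colim (J := J) (C := t.heart.FullSubcategory)).PreservesMonomorphisms :=
    ⟨fun α _ => t.mono_colim_map_heart S hS hS' α⟩
  hasExactColimitsOfShape_of_preservesMono _ J

end CategoryTheory.Triangulated.TStructure

/-! ### Finitely presented objects and separators from a generating class -/

lemma ObjectProperty.isClosedUnderColimitsOfShape_of_finite {C : Type*} [Category* C] [Preadditive C]
    [HasFiniteCoproducts C] [HasCokernels C] (P : ObjectProperty C)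
    [P.IsClosedUnderFiniteCoproducts] [P.IsClosedUnderCokernels] [P.IsClosedUnderIsomorphisms]
    (J : Type w) [SmallCategory J] [Finite J] [∀ i j : J, Finite (i ⟶ j)] :
    P.IsClosedUnderColimitsOfShape J where
  colimitsOfShape_le := by
    rintro X ⟨h⟩
    let F := h.diag
    let c₁ : Cofan (fun f : Σ p : J × J, p.1 ⟶ p.2 => F.obj f.1.1) := Cofan.mk _ (Sigma.ι _)
    let c₂ : Cofan F.obj := Cofan.mk _ (Sigma.ι _)
    let s : c₁.pt ⟶ c₂.pt := Sigma.desc fun f => F.map f.2 ≫ Sigma.ι F.obj f.1.2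
    let t : c₁.pt ⟶ c₂.pt := Sigma.desc fun f => Sigma.ι F.obj f.1.1
    have hs : P (cokernel (s - t)) := P.prop_cokernel (s - t)
      (P.prop_coproduct (fun f => h.prop_diag_obj f.1.1)) (P.prop_coproduct h.prop_diag_obj)
    have hi := HasColimitOfHasCoproductsOfHasCoequalizers.buildIsColimit s t
      (fun f => Sigma.ι_desc _ _) (fun f => Sigma.ι_desc _ _) (coproductIsCoproduct _)
      (coproductIsCoproduct _)
      (Preadditive.isColimitCoforkOfCokernelCofork (cokernelIsCokernel (s - t)))
    exact P.prop_of_iso (IsColimit.coconePointUniqueUpToIso hi h.isColimit) hs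

/-- Finitely presented objects are the closure, under finite colimits, of a small strong generator
consisting of finitely presented objects. `P` contains such a generator up to isomorphism and is
closed under finite colimits. -/
lemma isFinitelyPresentable_le_of_isGeneratingClass {C : Type*} [Category* C] [Abelian C]
    [LocallySmall.{w} C] [HasColimitsOfSize.{w, w} C] (P : ObjectProperty C)
    [P.IsClosedUnderFiniteCoproducts] [P.IsClosedUnderCokernels] [P.IsClosedUnderIsomorphisms]
    [ObjectProperty.EssentiallySmall.{w} P] (hP : IsGeneratingClass.{w} P)
    (hP' : P ≤ ObjectProperty.isFinitelyPresentable.{w} C) :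
    ObjectProperty.isFinitelyPresentable.{w} C ≤ P := by
  have : Fact Cardinal.aleph0.{w}.IsRegular := Cardinal.fact_isRegular_aleph0
  obtain ⟨Q, _, hQ, hPQ⟩ := ObjectProperty.EssentiallySmall.exists_small_le.{w} P
  refine (IsStrongGenerator.colimitsCardinalClosure_eq_isCardinalPresentable (κ := Cardinal.aleph0)
    (hP.of_le_isoClosure hPQ).isStrongGenerator (hQ.trans hP')).le.trans
    (ObjectProperty.colimitsCardinalClosure_le _ _ (fun J _ hJ => ?_) hQ)
  rw [hasCardinalLT_aleph0_iff] at hJ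
  have : Finite J := Finite.of_injective (fun j => Arrow.mk (𝟙 j)) (fun i j h => by
    simpa using congr_arg Comma.left h)
  have (i j : J) : Finite (i ⟶ j) := Finite.of_injective (fun f => Arrow.mk f)
    (fun f g h => Arrow.mk_injective _ _ h)
  exact ObjectProperty.isClosedUnderColimitsOfShape_of_finite P J

lemma IsGeneratingClass.hasSeparator {C : Type*} [Category* C] [Abelian C]
    [HasColimitsOfSize.{w, w} C] {P : ObjectProperty C} [ObjectProperty.EssentiallySmall.{w} P]
    (hP : IsGeneratingClass.{w} P) : HasSeparator C := by
  obtain ⟨Q, _, hQ, hPQ⟩ := ObjectProperty.EssentiallySmall.exists_small_le.{w} P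
  let f : Shrink.{w} (Subtype Q) → C := fun x => ((equivShrink _).symm x).1
  have hf : Q = .ofObj f := by
    ext X
    refine ⟨fun hX => ?_, ?_⟩
    · have := ObjectProperty.ofObj_apply f (equivShrink _ ⟨X, hX⟩)
      simpa [f] using this
    · rintro ⟨x⟩
      exact ((equivShrink _).symm x).2
  have := (hP.of_le_isoClosure hPQ).isStrongGenerator.isSeparating
  rw [hf] at this
  exact ⟨⟨_, (isSeparator_sigma f).2 this⟩⟩

lemma ObjectProperty.essentiallySmall_inverseImage_ι {C : Type*} [Category* C]
    (P Q : ObjectProperty C) [ObjectProperty.EssentiallySmall.{w} P] :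
    ObjectProperty.EssentiallySmall.{w} (P.inverseImage Q.ι) := by
  have : ObjectProperty.EssentiallySmall.{w} (P ⊓ Q) := .of_le (Q := P) inf_le_left
  obtain ⟨R, _, hR, hR'⟩ := ObjectProperty.EssentiallySmall.exists_small_le.{w} (P ⊓ Q)
  refine ⟨R.inverseImage Q.ι, ?_, fun X hX => ?_⟩
  · exact small_of_injective (β := Subtype R) (f := fun X => ⟨X.1.obj, X.2⟩) (by
      rintro ⟨⟨X, _⟩, _⟩ ⟨⟨Y, _⟩, _⟩ h
      obtain rfl : X = Y := congr_arg Subtype.val h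
      rfl)
  · obtain ⟨Y, hY, ⟨e⟩⟩ := hR' _ ⟨hX, X.property⟩
    exact ⟨⟨Y, (hR _ hY).2⟩, hY, ⟨Q.fullyFaithfulι.preimageIso e⟩⟩

lemma preservesColimitsOfShape_of_forall_directed {C D : Type*} [Category* C] [Category* D]
    (H : C ⥤ D) (h : ∀ (I : Type w) [PartialOrder I] [IsDirectedOrder I] [Nonempty I]
      (M : I ⥤ C), PreservesColimit M H) (J : Type w) [SmallCategory J] [IsFiltered J] :
    PreservesColimitsOfShape J H where
  preservesColimit {M} := by
    obtain ⟨I, _, _, _, F, _⟩ := IsFiltered.exists_directed J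
    have := h I (F ⋙ M)
    exact Functor.Final.preservesColimit_of_comp F

/-! ### The heart under the hypotheses of the proposition -/

section

variable {G : Type u} [Category.{v} G] [Abelian G] [HasDerivedCategory.{w} G]
  (t : TStructure (DerivedCategory G))

open DerivedCategory

/-- Passing to right orthogonals reverses the inclusion of aisles; the shift by -1 is needed because
the orthogonal of `t.le 0` is `t.ge 1`. -/
lemma isGE_of_ge_zero {m : ℤ} (hm : TStructure.t.le m ≤ t.le 0) (Z : DerivedCategory G)
    (hZ : t.ge 0 Z) : Z.IsGE m := by
  have : t.IsGE Z 0 := ⟨hZ⟩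
  have := t.isGE_shift Z 0 (-1) 1
  have : TStructure.t.IsGE (Z⟦(-1 : ℤ)⟧) (m + 1) := by
    rw [TStructure.t.isGE_iff_orthogonal m (m + 1) rfl]
    intro Y f hY
    have : t.IsLE Y 0 := ⟨hm _ hY.le⟩
    exact t.zero f 0 1 (by lia)
  exact TStructure.t.isGE_of_shift Z m (-1) (m + 1)

lemma bounded_of_heart {m n : ℤ} (hm : TStructure.t.le m ≤ t.le 0)
    (hn : t.le 0 ≤ TStructure.t.le n) (X : DerivedCategory G) (hX : t.heart X) :
    TStructure.t.bounded X :=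
  ⟨⟨m, isGE_of_ge_zero t hm X hX.2⟩, ⟨n, ⟨hn _ hX.1⟩⟩⟩

lemma locallySmall_heart [IsGrothendieckAbelian.{v} G] {m n : ℤ}
    (hm : TStructure.t.le m ≤ t.le 0) (hn : t.le 0 ≤ TStructure.t.le n) :
    LocallySmall.{v} t.heart.FullSubcategory where
  hom_small X Y := by
    have : Small.{v} (X.obj ⟶ Y.obj) := small_hom_of_bounded
      (bounded_of_heart t hm hn _ X.property) (bounded_of_heart t hm hn _ Y.property)
    exact small_of_injective (β := X.obj ⟶ Y.obj) t.heart.ι.map_injective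

lemma hasColimits_heart [IsGrothendieckAbelian.{v} G] {m : ℤ}
    (hm : TStructure.t.le m ≤ t.le 0) :
    HasColimitsOfSize.{v, v} t.heart.FullSubcategory := by
  have : HasCoproducts.{v} t.heart.FullSubcategory := fun J => by
    suffices ∀ X : J → t.heart.FullSubcategory, HasCoproduct X from
      ⟨fun F => have := this (fun j => F.obj ⟨j⟩); hasColimit_of_iso Discrete.natIsoFunctor⟩
    intro X
    obtain ⟨Y, i, hY⟩ := exists_coproduct_of_isGE (fun j => (X j).obj)
    exact t.hasCoproduct_heart X i (fun Z hZ => hY Z m (isGE_of_ge_zero t hm Z hZ))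
  exact has_colimits_of_hasCoequalizers_and_coproducts

variable (hG : IsLocallyCoherentGrothendieck.{v} G) (S : ObjectProperty G)
  (hS_fp : S ≤ ObjectProperty.isFinitelyPresentable.{v} G) (hS_gen : IsGeneratingClass.{v} S)
  (h_lim : ∀ (I : Type v) [PartialOrder I] [IsDirectedOrder I] [Nonempty I]
    (M : I ⥤ t.heart.FullSubcategory) (X : G) (_ : S X) (k : ℤ),
    PreservesColimit M (t.heart.ι ⋙ coyoneda.obj (op (((singleFunctor G 0).obj X)⟦k⟧))))

include h_lim in
lemma shiftedHomColimBijective_ι_mapCocone {J : Type v} [SmallCategory J] [IsFiltered J]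
    {F : J ⥤ t.heart.FullSubcategory} {c : Cocone F} (hc : IsColimit c) (A : G) (hA : S A) :
    ShiftedHomColimBijective (t.heart.ι.mapCocone c) ((singleFunctor G 0).obj A) := fun k => by
  have := preservesColimitsOfShape_of_forall_directed _ (fun I _ _ _ M => h_lim I M A hA k) J
  exact homColim_of_isColimit_coyoneda (isColimitOfPreserves
    (t.heart.ι ⋙ coyoneda.obj (op (((singleFunctor G 0).obj A)⟦k⟧))) hc)

include h_lim hS_gen in
lemma ab5_heart [IsGrothendieckAbelian.{v} G]
    [HasFilteredColimitsOfSize.{v, v} t.heart.FullSubcategory]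
    {m : ℤ} (hm : TStructure.t.le m ≤ t.le 0) :
    AB5OfSize.{v, v} t.heart.FullSubcategory where
  ofShape J _ _ := by
    refine t.hasExactColimitsOfShape_heart J
      (fun s : DerivedCategory G => ∃ A, S A ∧ ∃ n : ℤ, s = ((singleFunctor G 0).obj A)⟦n⟧) ?_ (fun K hK => ?_)
    · rintro _ ⟨A, hA, n, rfl⟩ F
      exact (ShiftedHomColimBijective _).le_shift n _
        (shiftedHomColimBijective_ι_mapCocone t S h_lim (colimit.isColimit F) A hA)
    · have : TStructure.t.IsGE K.obj m := isGE_of_ge_zero t hm K.obj K.property.2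
      have : TStructure.t.IsGE (K.obj⟦(1 : ℤ)⟧) (m - 1) := TStructure.t.isGE_shift K.obj m 1 (m - 1)
      have h := isZero_of_forall_shift_hom_eq_zero hS_gen (K.obj⟦(1 : ℤ)⟧) (m - 1)
        (fun A hA n x => hK _ ⟨A, hA, n, rfl⟩ x)
      rw [IsZero.iff_id_eq_zero] at h ⊢
      refine (t.heart.ι ⋙ shiftFunctor _ (1 : ℤ)).map_injective ?_
      rw [CategoryTheory.Functor.map_id, Functor.map_zero]
      exact h

include hG hS_fp hS_gen h_lim in
-- The colimit is taken in the heart, and the bijection known in the derived category descends along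
-- the fully faithful inclusion.
lemma inverseImage_boundedFP_le_isFinitelyPresentable {m : ℤ}
    (hm : TStructure.t.le m ≤ t.le 0) :
    (boundedFP G).inverseImage t.heart.ι ≤
      ObjectProperty.isFinitelyPresentable.{v} t.heart.FullSubcategory := fun X hX => by
  refine isFinitelyPresentable_iff_preservesFilteredColimitsOfSize.2
    ⟨fun J _ _ => ⟨fun {F} => ⟨fun {c} hc => ?_⟩⟩⟩
  obtain ⟨h₁, h₂⟩ := (shiftedHomColimBijective_of_boundedFP hG hS_fp hS_gen
    (fun A hA => shiftedHomColimBijective_ι_mapCocone t S h_lim hc A hA) m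
    (fun j => isGE_of_ge_zero t hm _ (F.obj j).property.2)
    (isGE_of_ge_zero t hm _ c.pt.property.2) _ hX).homColim
  refine nonempty_isColimit_coyoneda (fun j g hg => ?_) (fun g => ?_)
  · obtain ⟨k, u, hu⟩ := h₁ (t.heart.ι.map g) (by
      rw [Functor.mapCocone_ι_app, ← Functor.map_comp, hg, Functor.map_zero])
    refine ⟨k, u, t.heart.ι.map_injective ?_⟩
    rw [Functor.map_comp, Functor.map_zero]
    exact hu
  · obtain ⟨j, g', hg'⟩ := h₂ (t.heart.ι.map g)
    refine ⟨j, t.heart.ι.preimage g', t.heart.ι.map_injective ?_⟩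
    rw [Functor.map_comp, Functor.map_preimage]
    exact hg'

end

theorem mainTheorem4
    (G : Type u) [Category.{v} G] [Abelian G] [HasDerivedCategory.{max w v} G]
    (hG : IsLocallyCoherentGrothendieck.{v} G)
    -- `S` is a set of finitely presented generators of `G`
    (S : ObjectProperty G) (hS_small : ObjectProperty.Small.{v} S)
    (hS_fp : S ≤ ObjectProperty.isFinitelyPresentable.{v} G)
    (hS_gen : IsGeneratingClass.{v} S)
    -- the t-structure, with aisle `t.le 0`, co-aisle `t.ge 1` and heart `t.heart`
    (t : TStructure (DerivedCategory G))
    (h_restricts : TStructureRestrictsTo t (boundedFP G))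
    (h_bounds : ∃ m n : ℤ, m ≤ n ∧
      DerivedCategory.TStructure.t.le m ≤ t.le 0 ∧ t.le 0 ≤ DerivedCategory.TStructure.t.le n)
    (h_gen : IsGeneratingClass.{v} ((boundedFP G).inverseImage t.heart.ι))
    -- `Hom(S[k], -)` commutes with direct limits in the heart
    (h_lim : ∀ (I : Type v) [PartialOrder I] [IsDirectedOrder I] [Nonempty I]
      (M : I ⥤ t.heart.FullSubcategory) (X : G) (_ : S X) (k : ℤ),
      PreservesColimit M (t.heart.ι ⋙
        coyoneda.obj (op (((DerivedCategory.singleFunctor G 0).obj X)⟦k⟧)))) :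
    ∃ _ : Abelian t.heart.FullSubcategory,
      IsLocallyCoherentGrothendieck.{v} t.heart.FullSubcategory ∧
      ObjectProperty.isFinitelyPresentable.{v} t.heart.FullSubcategory =
        (boundedFP G).inverseImage t.heart.ι := by
  obtain ⟨m, n, -, hm, hn⟩ := h_bounds
  refine ⟨t.abelianHeart, ?_⟩
  have := hG.isGrothendieckAbelian
  have := hG.isTriangulated_boundedFP
  have := hG.essentiallySmall_boundedFP
  have := locallySmall_heart t hm hn
  have := hasColimits_heart t hm
  have := ab5_heart t S hS_gen h_lim hm
  have := ObjectProperty.essentiallySmall_inverseImage_ι.{v} (boundedFP G) t.heart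
  have hk := t.isClosedUnderKernels_inverseImage_heart h_restricts
  have hc := t.isClosedUnderCokernels_inverseImage_heart h_restricts
  have hp : ((boundedFP G).inverseImage t.heart.ι).IsClosedUnderFiniteProducts := by
    have : (boundedFP G).IsClosedUnderFiniteProducts := inferInstance
    exact ⟨fun J _ => inferInstance⟩
  have : HasFiniteBiproducts t.heart.FullSubcategory := Abelian.hasFiniteBiproducts
  have hp' := ObjectProperty.isClosedUnderFiniteCoproducts_of_isClosedUnderFiniteProducts
    ((boundedFP G).inverseImage t.heart.ι)
  have hle := inverseImage_boundedFP_le_isFinitelyPresentable t hG S hS_fp hS_gen h_lim hm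
  -- Condition 3 gives the reverse inclusion: the class generates, is essentially small, and is
  -- closed under finite coproducts and cokernels.
  have heq := le_antisymm (isFinitelyPresentable_le_of_isGeneratingClass _ h_gen hle) hle
  refine ⟨?_, heq⟩
  obtain ⟨Q, hQ, hQP, hPQ⟩ := ObjectProperty.EssentiallySmall.exists_small_le.{v}
    ((boundedFP G).inverseImage t.heart.ι)
  exact
    { isGrothendieckAbelian := { hasSeparator := h_gen.hasSeparator }
      exists_generators := ⟨Q, hQ, hQP.trans hle, h_gen.of_le_isoClosure hPQ⟩
      isAbelianExactSubcategory := by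
        rw [heq]
        exact ⟨hp, hp', hk, hc⟩ }
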